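/- Let $F \dashv U$ be the adjunction between small reflexive directed graphs and small categories, where $F$ forms the free category and $U$ forgets composition. For a small category $\mathsf A$, let $\mathfrak C\mathsf A$ be its free resolution: the simplicial category with the objects of $\mathsf A$ whose category of $n$-arrows is $(FU)^{n+1}\mathsf A$, with faces and degeneracies given by the resolution by the comonad $(FU,\epsilon,F\eta U)$. For a simplicial category $\mathbb S$, a homotopy coherent diagram of shape $\mathsf A$ in $\mathbb S$ is a simplicial functor $\mathfrak C\mathsf A\to\mathbb S$. Let $[n]=\{0\to 1\to\cdots\to n\}$. Let $\mathrm{Coh}(\mathsf A,\mathbb S)$ be the simplicial set whose $n$-simplices are the homotopy coherent diagrams of shape $\mathsf A\times[n]$ in $\mathbb S$, and let the homotopy coherent nerve $\mathfrak N\mathbb S$ be the simplicial set whose $n$-simplices are the homotopy coherent diagrams of shape $[n]$ in $\mathbb S$; simplicial operators act by restriction. Theorem. Let $\mathsf A$ be a small category and let $\mathbb S$ be a simplicial category all of whose mapping spaces are Kan complexes. Then the canonical map of simplicial sets $$\mathrm{Coh}(\mathsf A,\mathbb S)\longrightarrow (\mathfrak N\mathbb S)^{\mathsf A}$$ into the internal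 hom from the nerve of $\mathsf A$ to $\mathfrak N\mathbb S$ is an isomorphism. Here the canonical map is the transpose of the map $\mathsf A\times\mathrm{Coh}(\mathsf A,\mathbb S)\to\mathfrak N\mathbb S$ which sends a pair of $n$-simplices $(\sigma\colon[n]\to\mathsf A,\ D\colon\mathfrak C(\mathsf A\times[n])\to\mathbb S)$ to the restriction of $D$ along $(\sigma,\mathrm{id})\colon[n]\to\mathsf A\times[n]$. Moreover, $\mathrm{Coh}(\mathsf A,\mathbb S)$ is a quasi-category. -/

import Mathlib

open CategoryTheory MonoidalCategory

universe w u

namespace HoCoh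

/-! ### Categories with a prescribed set of objects

A `Category.{w} O` is regarded as a value: several category structures on the same set `O` of
objects (one for each `n`) have to be considered at the same time. -/

section FreeCategory

variable {O O' O'' : Type w}

/-- A functor `𝒞 ⥤ 𝒟` whose action on objects is the given function `f`. -/
structure FunctorOver (f : O → O') (𝒞 : Category.{w} O) (𝒟 : Category.{w} O') where
  map : ∀ {x y : O}, 𝒞.Hom x y → 𝒟.Hom (f x) (f y)
  map_id : ∀ x : O, map (𝒞.id x) = 𝒟.id (f x)
  map_comp : ∀ {x y z : O} (p : 𝒞.Hom x y) (q : 𝒞.Hom y z),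
    map (𝒞.comp p q) = 𝒟.comp (map p) (map q)

namespace FunctorOver

variable {f : O → O'} {g : O' → O''} {𝒞 : Category.{w} O} {𝒟 : Category.{w} O'}
  {ℰ : Category.{w} O''}

theorem ext {φ ψ : FunctorOver f 𝒞 𝒟}
    (h : ∀ (x y : O) (p : 𝒞.Hom x y), φ.map p = ψ.map p) : φ = ψ := by
  cases φ; cases ψ; congr; funext x y p; exact h x y p

/-- The identity functor. -/
def id (𝒞 : Category.{w} O) : FunctorOver (fun x : O => x) 𝒞 𝒞 where
  map p := p
  map_id _ := rfl
  map_comp _ _ := rfl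

/-- Composition of functors (in diagrammatic order). -/
def comp (φ : FunctorOver f 𝒞 𝒟) (ψ : FunctorOver g 𝒟 ℰ) :
    FunctorOver (fun x => g (f x)) 𝒞 ℰ where
  map p := ψ.map (φ.map p)
  map_id x := by rw [φ.map_id, ψ.map_id]
  map_comp p q := by rw [φ.map_comp, ψ.map_comp]

end FunctorOver

/-- The category `FU 𝒞`: the free category on the underlying reflexive quiver of `𝒞`,
with the same objects as `𝒞`. -/
@[reducible]
def free (𝒞 : Category.{w} O) : Category.{w} O where
  Hom x y := (Cat.FreeRefl.mk x : Cat.FreeRefl O) ⟶ Cat.FreeRefl.mk y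
  id x := 𝟙 (Cat.FreeRefl.mk x : Cat.FreeRefl O)
  comp p q := p ≫ q

namespace free

variable {𝒞 : Category.{w} O} {𝒟 : Category.{w} O'} {ℰ : Category.{w} O''}

/-- The unit `η` of the adjunction `F ⊣ U`: the inclusion of the generating arrows,
a morphism of reflexive quivers `U 𝒞 → UFU 𝒞`. -/
def unit {x y : O} (p : 𝒞.Hom x y) : (free 𝒞).Hom x y :=
  letI := 𝒞
  Cat.FreeRefl.homMk (V := O) p

theorem unit_id (x : O) : unit (𝒞.id x) = (free 𝒞).id x :=
  letI := 𝒞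
  Cat.FreeRefl.homMk_id (V := O) x

/-- The universal property of the free category: a morphism of reflexive quivers
`U 𝒞 → U 𝒟` extends to a functor `FU 𝒞 → 𝒟`. -/
def lift (f : O → O') (g : ∀ {x y : O}, 𝒞.Hom x y → 𝒟.Hom (f x) (f y))
    (hg : ∀ x : O, g (𝒞.id x) = 𝒟.id (f x)) : FunctorOver f (free 𝒞) 𝒟 where
  map p :=
    letI := 𝒞
    letI := 𝒟
    (Cat.FreeRefl.lift' (V := O) (D := O') f g hg).map p
  map_id x :=
    letI := 𝒞
    letI := 𝒟
    (Cat.FreeRefl.lift' (V := O) (D := O') f g hg).map_id (Cat.FreeRefl.mk x)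
  map_comp p q :=
    letI := 𝒞
    letI := 𝒟
    (Cat.FreeRefl.lift' (V := O) (D := O') f g hg).map_comp p q

theorem lift_unit (f : O → O') (g : ∀ {x y : O}, 𝒞.Hom x y → 𝒟.Hom (f x) (f y))
    (hg : ∀ x : O, g (𝒞.id x) = 𝒟.id (f x)) {x y : O} (p : 𝒞.Hom x y) :
    (lift (𝒟 := 𝒟) f g hg).map (unit p) = g p :=
  letI := 𝒞
  letI := 𝒟
  Cat.FreeRefl.lift'_map (V := O) (D := O') f g hg p

theorem hom_ext {f : O → O'} {φ ψ : FunctorOver f (free 𝒞) 𝒟}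
    (h : ∀ (x y : O) (p : 𝒞.Hom x y), φ.map (unit p) = ψ.map (unit p)) : φ = ψ := by
  let := 𝒞
  let := 𝒟
  let Φ (χ : FunctorOver f (free 𝒞) 𝒟) : Cat.FreeRefl O ⥤ O' :=
    { obj x := f x.as
      map {x y} p := χ.map (x := x.as) (y := y.as) p
      map_id x := χ.map_id x.as
      map_comp p q := χ.map_comp p q }
  have key : Φ φ = Φ ψ :=
    Cat.FreeRefl.functor_ext (fun _ => rfl) (fun p => by
      rw [eqToHom_refl, eqToHom_refl, Category.id_comp, Category.comp_id]
      exact h _ _ p)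
  refine FunctorOver.ext fun x y p => ?_
  have := Functor.congr_hom key (f := (show Cat.FreeRefl.mk x ⟶ Cat.FreeRefl.mk y from p))
  rw [eqToHom_refl, eqToHom_refl, Category.id_comp, Category.comp_id] at this
  exact this

/-- The action of `FU` on functors. -/
def map {f : O → O'} (φ : FunctorOver f 𝒞 𝒟) : FunctorOver f (free 𝒞) (free 𝒟) :=
  lift f (fun p => unit (φ.map p)) (fun x => by rw [φ.map_id, unit_id])

/-- The counit `ε : FU 𝒞 ⥤ 𝒞`, which composes strings of arrows. -/
def counit (𝒞 : Category.{w} O) : FunctorOver (fun x : O => x) (free 𝒞) 𝒞 :=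
  lift (fun x => x) (fun p => p) (fun _ => rfl)

/-- The comultiplication `F η U : FU 𝒞 ⥤ FUFU 𝒞`, which puts parentheses around each
individual generator. -/
def comult (𝒞 : Category.{w} O) : FunctorOver (fun x : O => x) (free 𝒞) (free (free 𝒞)) :=
  lift (fun x => x) (fun p => unit (unit p)) (fun x => by rw [unit_id, unit_id])

@[simp] theorem map_unit {f : O → O'} (φ : FunctorOver f 𝒞 𝒟) {x y : O} (p : 𝒞.Hom x y) :
    (map φ).map (unit p) = unit (φ.map p) := lift_unit _ _ _ _

@[simp] theorem counit_unit {x y : O} (p : 𝒞.Hom x y) : (counit 𝒞).map (unit p) = p :=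
  lift_unit _ _ _ _

@[simp] theorem comult_unit {x y : O} (p : 𝒞.Hom x y) :
    (comult 𝒞).map (unit p) = unit (unit p) :=
  lift_unit _ _ _ _

variable {f : O → O'} {g : O' → O''}

theorem map_ext {φ ψ : FunctorOver f (free 𝒞) 𝒟}
    (h : ∀ (x y : O) (p : 𝒞.Hom x y), φ.map (unit p) = ψ.map (unit p))
    {x y : O} (p : (free 𝒞).Hom x y) : φ.map p = ψ.map p := by
  rw [hom_ext h]

theorem counit_nat (φ : FunctorOver f 𝒞 𝒟) {x y : O} (p : (free 𝒞).Hom x y) :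
    (counit 𝒟).map ((map φ).map p) = φ.map ((counit 𝒞).map p) :=
  map_ext (φ := (map φ).comp (counit 𝒟)) (ψ := (counit 𝒞).comp φ)
    (fun _ _ _ => by simp [FunctorOver.comp]) p

theorem comult_nat (φ : FunctorOver f 𝒞 𝒟) {x y : O} (p : (free 𝒞).Hom x y) :
    (comult 𝒟).map ((map φ).map p) =
      (map (map φ)).map ((comult 𝒞).map p) :=
  map_ext (φ := (map φ).comp (comult 𝒟)) (ψ := (comult 𝒞).comp (map (map φ)))
    (fun _ _ _ => by simp [FunctorOver.comp]) p

theorem counit_comult {x y : O} (p : (free 𝒞).Hom x y) :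
    (counit (free 𝒞)).map ((comult 𝒞).map p) = p :=
  map_ext (φ := (comult 𝒞).comp (counit (free 𝒞))) (ψ := FunctorOver.id _)
    (fun _ _ _ => by simp [FunctorOver.comp, FunctorOver.id]) p

theorem map_counit_comult {x y : O} (p : (free 𝒞).Hom x y) :
    (map (counit 𝒞)).map ((comult 𝒞).map p) = p :=
  map_ext (φ := (comult 𝒞).comp (map (counit 𝒞))) (ψ := FunctorOver.id _)
    (fun _ _ _ => by simp [FunctorOver.comp, FunctorOver.id]) p

theorem comult_comult {x y : O} (p : (free 𝒞).Hom x y) :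
    (comult (free 𝒞)).map ((comult 𝒞).map p) =
      (map (comult 𝒞)).map ((comult 𝒞).map p) :=
  map_ext (φ := (comult 𝒞).comp (comult (free 𝒞)))
    (ψ := (comult 𝒞).comp (map (comult 𝒞)))
    (fun _ _ _ => by simp [FunctorOver.comp]) p

theorem map_map (φ : FunctorOver f 𝒞 𝒟) (ψ : FunctorOver g 𝒟 ℰ) {x y : O}
    (p : (free 𝒞).Hom x y) :
    (map ψ).map ((map φ).map p) = (map (φ.comp ψ)).map p :=
  map_ext (φ := (map φ).comp (map ψ)) (ψ := map (φ.comp ψ))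
    (fun _ _ _ => by simp [FunctorOver.comp]) p

theorem map_id {x y : O} (p : (free 𝒞).Hom x y) :
    (map (FunctorOver.id 𝒞)).map p = p :=
  map_ext (φ := map (FunctorOver.id 𝒞)) (ψ := FunctorOver.id _)
    (fun _ _ _ => by simp [FunctorOver.id]) p

end free

end FreeCategory

/-! ### The free resolution of a category -/

section

/-- The category `(FU)ⁿ A`, which has the same objects as `A`. -/
@[reducible]
def iter (A : Type w) [𝒜 : SmallCategory A] : ℕ → Category.{w} A
  | 0 => 𝒜
  | n + 1 => free (iter A n)

/-- The restriction of a monotone map to the elements other than the first one. -/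
def tail {m n : ℕ} (α : Fin (m + 1) →o Fin n) : Fin m →o Fin n where
  toFun i := α i.succ
  monotone' _ _ h := α.monotone (Fin.succ_le_succ_iff.2 h)

theorem ne_zero {m n : ℕ} (α : Fin (m + 1) →o Fin (n + 1)) (h : α 0 ≠ 0) (i : Fin (m + 1)) :
    α i ≠ 0 := fun hi => h (Fin.le_zero_iff.1 (hi ▸ α.monotone (Fin.zero_le i)))

/-- A monotone map with values `> 0`, shifted down by one. -/
def shift {m n : ℕ} (α : Fin m →o Fin (n + 1)) (h : ∀ i, α i ≠ 0) : Fin m →o Fin n where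
  toFun i := (α i).pred (h i)
  monotone' _ _ hij := Fin.pred_le_pred_iff.2 (α.monotone hij)

/-- The action `(FU)ⁿ A ⥤ (FU)ᵐ A` of a monotone map `α : {0, …, m-1} → {0, …, n-1}` on the
resolution of `A` by the comonad `(FU, ε, δ = F η U)`. The index `0` stands for the leftmost
factor `FU`, i.e. for the outermost pair of parentheses: each `FU` which is not in the image
of `α` is removed by `ε`, and each `FU` whose index has several preimages is repeated by
means of `δ`. -/
def op (A : Type w) [SmallCategory A] : (m n : ℕ) → (Fin m →o Fin n) →
    FunctorOver (fun x : A => x) (iter A n) (iter A m)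
  | 0, 0, _ => FunctorOver.id _
  | 0, n + 1, α => (free.counit (iter A n)).comp (op A 0 n (shift α (fun i => i.elim0)))
  | _ + 1, 0, α => (α 0).elim0
  | m + 1, n + 1, α =>
      if h : α 0 = 0 then
        (free.comult (iter A n)).comp (free.map (op A m (n + 1) (tail α)))
      else
        (free.counit (iter A n)).comp (op A (m + 1) n (shift α (ne_zero α h)))
  termination_by m n => m + n

section

variable {A : Type w} [SmallCategory A]

theorem op_zero_succ {n : ℕ} (α : Fin 0 →o Fin (n + 1)) {x y : A}
    (p : (iter A (n + 1)).Hom x y) :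
    (op A 0 (n + 1) α).map p =
      (op A 0 n (shift α (fun i => i.elim0))).map ((free.counit (iter A n)).map p) := by
  rw [op]; rfl

theorem op_of_eq {m n : ℕ} (α : Fin (m + 1) →o Fin (n + 1)) (h : α 0 = 0) {x y : A}
    (p : (iter A (n + 1)).Hom x y) :
    (op A (m + 1) (n + 1) α).map p =
      (free.map (op A m (n + 1) (tail α))).map ((free.comult (iter A n)).map p) := by
  rw [op, dif_pos h]; rfl

theorem op_of_ne {m n : ℕ} (α : Fin (m + 1) →o Fin (n + 1)) (h : α 0 ≠ 0) {x y : A}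
    (p : (iter A (n + 1)).Hom x y) :
    (op A (m + 1) (n + 1) α).map p =
      (op A (m + 1) n (shift α (ne_zero α h))).map ((free.counit (iter A n)).map p) := by
  rw [op, dif_neg h]; rfl

theorem counit_comult_iter {n : ℕ} {x y : A} (p : (iter A (n + 1)).Hom x y) :
    (free.counit (iter A (n + 1))).map ((free.comult (iter A n)).map p) = p :=
  free.counit_comult p

theorem comult_comult_iter {n : ℕ} {x y : A} (p : (iter A (n + 1)).Hom x y) :
    (free.comult (iter A (n + 1))).map ((free.comult (iter A n)).map p) =
      (free.map (free.comult (iter A n))).map ((free.comult (iter A n)).map p) :=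
  free.comult_comult p

/-- Skipping the first index amounts to applying `ε`. -/
theorem op_skip {m n : ℕ} (α : Fin m →o Fin (n + 1)) (h : ∀ i, α i ≠ 0) {x y : A}
    (p : (iter A (n + 1)).Hom x y) :
    (op A m (n + 1) α).map p = (op A m n (shift α h)).map ((free.counit (iter A n)).map p) := by
  cases m with
  | zero => exact op_zero_succ α p
  | succ m => exact op_of_ne α (h 0) p

theorem op_id {n : ℕ} {x y : A} (p : (iter A n).Hom x y) :
    (op A n n OrderHom.id).map p = p := by
  induction n generalizing x y with
  | zero => rw [op]; rfl
  | succ n ih =>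
    rw [op_of_eq _ rfl]
    have : op A n (n + 1) (tail OrderHom.id) = free.counit (iter A n) := by
      refine FunctorOver.ext fun x y p => ?_
      rw [op_skip _ (fun i => Fin.succ_ne_zero i)]
      exact ih _
    rw [this, free.map_counit_comult]

theorem op_comp {l m n : ℕ} (β : Fin l →o Fin m) (α : Fin m →o Fin n) {x y : A}
    (p : (iter A n).Hom x y) :
    (op A l n (α.comp β)).map p = (op A l m β).map ((op A m n α).map p) := by
  induction l generalizing m n x y with
  | zero =>
    induction m generalizing n x y with
    | zero =>
      rw [Subsingleton.elim β OrderHom.id, op_id]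
      congr 2
    | succ m ihm =>
      induction n generalizing x y with
      | zero => exact (α 0).elim0
      | succ n ihn =>
        by_cases h : α 0 = 0
        · rw [op_of_eq α h, op_zero_succ β, free.counit_nat, counit_comult_iter, ← ihm]
          congr 2
          ext i
          exact i.elim0
        · rw [op_of_ne α h, op_zero_succ, ← ihn]
          congr 2
  | succ l ihl =>
    induction m generalizing n x y with
    | zero => exact (β 0).elim0
    | succ m ihm =>
      induction n generalizing x y with
      | zero => exact (α 0).elim0
      | succ n ihn =>
        by_cases h : α 0 = 0
        · by_cases h' : β 0 = 0
          · rw [op_of_eq α h, op_of_eq β h', op_of_eq (α.comp β) (by simp [h, h']), free.comult_nat, comult_comult_iter,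
              free.map_map, free.map_map]
            congr 2
            refine FunctorOver.ext fun x y p => ?_
            have : tail (α.comp β) = α.comp (tail β) := rfl
            rw [this, ihl, FunctorOver.comp, FunctorOver.comp]
            rw [op_of_eq α h]
          · rw [op_of_eq α h, op_of_ne β h', free.counit_nat, counit_comult_iter, ← ihm]
            congr 2
            ext i
            exact congrArg (fun j => (α j : ℕ)) (Fin.succ_pred (β i) (ne_zero β h' i)).symm
        · have h' : (α.comp β) 0 ≠ 0 := ne_zero α h _
          rw [op_of_ne α h, op_of_ne _ h', ← ihn]
          congr 2

/-- The functor `(FU)ⁿ A ⥤ (FU)ⁿ B` induced by a functor `A ⥤ B`. -/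
def iterMap {A B : Type w} [SmallCategory A] [SmallCategory B] (H : A ⥤ B) :
    (n : ℕ) → FunctorOver H.obj (iter A n) (iter B n)
  | 0 => ⟨H.map, H.map_id, H.map_comp⟩
  | n + 1 => free.map (iterMap H n)

theorem iterMap_id {n : ℕ} {x y : A} (p : (iter A n).Hom x y) :
    (iterMap (𝟭 A) n).map p = p := by
  induction n generalizing x y with
  | zero => rfl
  | succ n ih =>
    have : iterMap (𝟭 A) n = FunctorOver.id (iter A n) := FunctorOver.ext fun _ _ p => ih p
    change (free.map (iterMap (𝟭 A) n)).map p = p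
    rw [this]
    exact free.map_id p

theorem iterMap_comp {B C : Type w} [SmallCategory B] [SmallCategory C] (H : A ⥤ B) (K : B ⥤ C)
    {n : ℕ} {x y : A} (p : (iter A n).Hom x y) :
    (iterMap (H ⋙ K) n).map p = (iterMap K n).map ((iterMap H n).map p) := by
  induction n generalizing x y with
  | zero => rfl
  | succ n ih =>
    have : iterMap (H ⋙ K) n = (iterMap H n).comp (iterMap K n) :=
      FunctorOver.ext fun _ _ p => ih p
    change (free.map (iterMap (H ⋙ K) n)).map p =
      (free.map (iterMap K n)).map ((free.map (iterMap H n)).map p)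
    rw [this]
    exact (free.map_map _ _ p).symm

theorem counit_iterMap {B : Type w} [SmallCategory B] (H : A ⥤ B) {n : ℕ} {x y : A}
    (p : (iter A (n + 1)).Hom x y) :
    (free.counit (iter B n)).map ((iterMap H (n + 1)).map p) =
      (iterMap H n).map ((free.counit (iter A n)).map p) :=
  free.counit_nat _ p

theorem comult_iterMap {B : Type w} [SmallCategory B] (H : A ⥤ B) {n : ℕ} {x y : A}
    (p : (iter A (n + 1)).Hom x y) :
    (free.comult (iter B n)).map ((iterMap H (n + 1)).map p) =
      (free.map (iterMap H (n + 1))).map ((free.comult (iter A n)).map p) :=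
  free.comult_nat _ p

theorem op_iterMap {B : Type w} [SmallCategory B] (H : A ⥤ B) {m n : ℕ} (α : Fin m →o Fin n)
    {x y : A} (p : (iter A n).Hom x y) :
    (op B m n α).map ((iterMap H n).map p) = (iterMap H m).map ((op A m n α).map p) := by
  induction m generalizing n x y with
  | zero =>
    induction n generalizing x y with
    | zero => rw [op, op]; rfl
    | succ n ihn => rw [op_zero_succ, op_zero_succ, counit_iterMap, ihn]
  | succ m ihm =>
    induction n generalizing x y with
    | zero => exact (α 0).elim0
    | succ n ihn =>
      by_cases h : α 0 = 0
      · rw [op_of_eq α h, op_of_eq α h, comult_iterMap, free.map_map]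
        change _ = (free.map (iterMap H m)).map _
        rw [free.map_map]
        congr 2
        exact FunctorOver.ext fun _ _ p => ihm _ p
      · rw [op_of_ne α h, op_of_ne α h, counit_iterMap, ihn]

end

/-- The underlying type of objects of the free resolution `ℭ A` of a category `A`. -/
structure Resolution (A : Type w) : Type w where
  /-- The underlying object of `A`. -/
  as : A

namespace Resolution

/-- The mapping space `ℭ A (x, y)`: its `n`-simplices are the `n`-arrows from `x` to `y`, that
is, the morphisms from `x` to `y` in the category `(FU)ⁿ⁺¹ A`. -/
def mapSpace {A : Type w} [SmallCategory A] (x y : A) : SSet.{w} where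
  obj n := (iter A (n.unop.len + 1)).Hom x y
  map α := ↾fun p => (op A _ _ α.unop.toOrderHom).map p
  map_id n := by
    ext p
    exact op_id p
  map_comp α β := by
    ext p
    exact op_comp _ _ p

/-- The free resolution `ℭ A` as a simplicial category. -/
instance (A : Type w) [SmallCategory A] : EnrichedCategory SSet.{w} (Resolution A) where
  Hom x y := mapSpace x.as y.as
  id x := { app n := ↾fun _ => (iter A (n.unop.len + 1)).id x.as
            naturality _ _ α := by
              ext _
              exact ((op A _ _ α.unop.toOrderHom).map_id _).symm }
  comp x y z := { app n := ↾fun p => (iter A (n.unop.len + 1)).comp p.1 p.2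
                  naturality _ _ α := by
                    ext p
                    exact ((op A _ _ α.unop.toOrderHom).map_comp p.1 p.2).symm }
  id_comp x y := by
    ext n p
    exact (iter A (n.unop.len + 1)).id_comp p
  comp_id x y := by
    ext n p
    exact (iter A (n.unop.len + 1)).comp_id p
  assoc _ _ _ _ := by
    ext n p
    exact (iter A (n.unop.len + 1)).assoc p.1 p.2.1 p.2.2

/-- The simplicial functor `ℭ A → ℭ B` induced by a functor `A ⥤ B`. -/
def functor {A B : Type w} [SmallCategory A] [SmallCategory B] (H : A ⥤ B) :
    EnrichedFunctor SSet.{w} (Resolution A) (Resolution B) where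
  obj x := ⟨H.obj x.as⟩
  map x y := { app n := ↾fun p => (iterMap H (n.unop.len + 1)).map p
               naturality _ _ α := by
                 ext p
                 exact (op_iterMap H α.unop.toOrderHom p).symm }
  map_id x := by
    ext n _
    exact (iterMap H (n.unop.len + 1)).map_id x.as
  map_comp x y z := by
    ext n p
    exact (iterMap H (n.unop.len + 1)).map_comp p.1 p.2

theorem functor_id (A : Type w) [SmallCategory A] :
    functor (𝟭 A) = EnrichedFunctor.id SSet.{w} (Resolution A) := by
  refine EnrichedFunctor.ext _ (fun _ => rfl) fun x y => ?_
  ext n p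
  exact iterMap_id p

theorem functor_comp {A B C : Type w} [SmallCategory A] [SmallCategory B] [SmallCategory C]
    (H : A ⥤ B) (K : B ⥤ C) :
    functor (H ⋙ K) = (functor H).comp SSet.{w} (functor K) := by
  refine EnrichedFunctor.ext _ (fun _ => rfl) fun x y => ?_
  ext n p
  exact iterMap_comp H K p

end Resolution

end

/-! ### Homotopy coherent diagrams and the homotopy coherent nerve -/

section

/-- The ordinal category `[n] = {0 → 1 → ⋯ → n}`, in the universe `w`. -/
abbrev Ord (n : SimplexCategory) : Type w := ULift.{w} (Fin (n.len + 1))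

/-- The functor `[m] ⥤ [n]` given by a monotone map. -/
def ordFunctor {m n : SimplexCategory} (α : m ⟶ n) : Ord.{w} m ⥤ Ord.{w} n :=
  α.toOrderHom.uliftMap.monotone.functor

/-- The isomorphism of categories from `[n]` in the universe `w` to `Fin (n + 1)`. -/
def ordDown (n : SimplexCategory) : Ord.{w} n ⥤ Fin (n.len + 1) :=
  Monotone.functor (f := ULift.down) fun _ _ h => h

/-- A homotopy coherent diagram of shape `A` in the simplicial category `S`: a simplicial
functor `ℭ A → S`. -/
abbrev CoherentDiagram (A : Type w) [SmallCategory A] (S : Type u) [EnrichedCategory SSet.{w} S] :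
    Type (max u w) :=
  EnrichedFunctor SSet.{w} (Resolution A) S

variable (A : Type w) [SmallCategory A] (S : Type u) [EnrichedCategory SSet.{w} S]

variable {S} in
/-- The restriction of a homotopy coherent diagram along a functor between the shapes. -/
def CoherentDiagram.restrict {A B : Type w} [SmallCategory A] [SmallCategory B] (H : A ⥤ B)
    (F : CoherentDiagram B S) : CoherentDiagram A S :=
  (Resolution.functor H).comp SSet.{w} F

/-- The simplicial set `Coh(A, S)`, whose `n`-simplices are the homotopy coherent diagrams of
shape `A × [n]` in `S`. -/
def Coh : SSet.{max u w} where
  obj n := CoherentDiagram (A × Ord.{w} n.unop) S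
  map α := ↾fun F => F.restrict ((𝟭 A).prod (ordFunctor α.unop))
  map_id n := by
    ext F
    change ((Resolution.functor (𝟭 _)).comp SSet.{w} F) = F
    rw [Resolution.functor_id]
    rfl
  map_comp α β := by
    ext F
    change (Resolution.functor (((𝟭 A).prod (ordFunctor β.unop)) ⋙
      ((𝟭 A).prod (ordFunctor α.unop)))).comp SSet.{w} F = _
    rw [Resolution.functor_comp]
    rfl

/-- The homotopy coherent nerve `𝔑 S`, whose `n`-simplices are the homotopy coherent diagrams
of shape `[n]` in `S`. -/
def hcNerve : SSet.{max u w} where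
  obj n := CoherentDiagram (Ord.{w} n.unop) S
  map α := ↾fun F => F.restrict (ordFunctor α.unop)
  map_id n := by
    ext F
    change ((Resolution.functor (𝟭 _)).comp SSet.{w} F) = F
    rw [Resolution.functor_id]
    rfl
  map_comp α β := by
    ext F
    change (Resolution.functor ((ordFunctor β.unop) ⋙ (ordFunctor α.unop))).comp SSet.{w} F = _
    rw [Resolution.functor_comp]
    rfl

/-- The nerve of the small category `A`, in the universe of `𝔑 S`. -/
abbrev liftedNerve : SSet.{max u w} := SSet.uliftFunctor.{u, w}.obj (nerve A)

variable {A} in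
/-- The functor `(σ, id) : [n] ⥤ A × [n]` given by an `n`-simplex `σ` of the nerve of `A`. -/
def graph {n : SimplexCategory} (σ : ComposableArrows A n.len) : Ord.{w} n ⥤ A × Ord.{w} n :=
  (ordDown n ⋙ σ).prod' (𝟭 (Ord.{w} n))

/-- The evaluation map `A × Coh(A, S) → 𝔑 S`, which sends an `n`-simplex `σ : [n] ⥤ A` of the
nerve of `A` and a homotopy coherent diagram `F` of shape `A × [n]` to the restriction of `F`
along `(σ, id) : [n] ⥤ A × [n]`. -/
def evaluation : liftedNerve.{w, u} A ⊗ Coh A S ⟶ hcNerve.{w, u} S where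
  app n := ↾fun p => CoherentDiagram.restrict (graph (n := n.unop) p.1.down) p.2
  naturality m n α := by
    ext p
    have key : graph (n := n.unop) ((nerve A).map α p.1.down) ⋙
        (𝟭 A).prod (ordFunctor α.unop) =
        ordFunctor α.unop ⋙ graph (n := m.unop) p.1.down := rfl
    change (Resolution.functor (graph (n := n.unop) ((nerve A).map α p.1.down))).comp SSet.{w}
      ((Resolution.functor ((𝟭 A).prod (ordFunctor α.unop))).comp SSet.{w} p.2) =
      (Resolution.functor (ordFunctor α.unop)).comp SSet.{w}
        ((Resolution.functor (graph (n := m.unop) p.1.down)).comp SSet.{w} p.2)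
    have key' := congrArg (fun H => (Resolution.functor H).comp SSet.{w} p.2) key
    simp only [Resolution.functor_comp] at key'
    exact key'

/-- The canonical map `Coh(A, S) → (𝔑 S)^A` into the internal hom of simplicial sets, the
transpose of the evaluation map. -/
noncomputable def toInternalHom :
    Coh A S ⟶ (ihom (liftedNerve.{w, u} A)).obj (hcNerve.{w, u} S) :=
  MonoidalClosed.curry (evaluation A S)

end

end HoCoh

/-! A simplicial functor out of `ℭ B` amounts to a family of simplicial functors out of `ℭ [k]`, one
for each simplex `[k] ⥤ B`, compatible with simplicial operators. A simplex of `A × [n]` is a pair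
of a simplex of the nerve of `A` and an operator into `[n]`, so for `B = A × [n]` such families are
the `n`-simplices of `(𝔑 S)^A`. This correspondence is the canonical map.

A diagram is determined by its restrictions because every arrow of `(FU)ᵐ B` comes from some
simplex: the strings of arrows inside it can be concatenated (`exists_lift`). To construct a diagram
from a family, the value on an arrow must not depend on the simplex it is lifted to. Arrows of
`(FU)ᵐ [k]` are chains of subsets of intervals (`chainOf_injective`, `exists_chainOf_eq`), so a
lifted arrow is a string in `B` with marked positions, considered up to operators that preserve the
ends and transport the marks. By the universal property of free categories, `(FU)ᵐ B` acts on
classes of marked strings. The extension evaluates the family on the class that an arrow produces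
from the string of length zero, and `act_upperString` computes this class for an arrow coming from a
simplex. Functoriality can then be checked inside one simplex.

For the last claim it suffices that `𝔑 S` is a quasi-category. An inner horn with index `k`
prescribes the filler on chains that omit a vertex other than `k`, and hence, by functoriality, on
concatenations at an interior vertex. What is left concerns only the mapping space from the first to
the last vertex, a cube with one coordinate for each interior vertex. There the prescribed part
consists of all faces except the one where the coordinate `k` is `0`. Its inclusion is a retract of
a pushout product with the end `1` of an interval, hence anodyne, and the Kan condition gives the
extension (`exists_chain_extension`). -/

namespace HoCoh

namespace free

variable {O : Type w} {𝒞 : Category.{w} O}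

theorem hom_induction {motive : ∀ {x y : O}, (free 𝒞).Hom x y → Prop}
    (id : ∀ x : O, motive ((free 𝒞).id x))
    (comp_unit : ∀ {x y z : O} (p : (free 𝒞).Hom x y) (q : 𝒞.Hom y z), motive p →
      motive ((free 𝒞).comp p (unit q)))
    {x y : O} (p : (free 𝒞).Hom x y) : motive p := by
  let := 𝒞
  refine Cat.FreeRefl.hom_induction (V := O)
    (motive := fun {x y} f => motive (x := x.as) (y := y.as) f) ?_ ?_ p
  · intro x
    have := id x
    rw [← unit_id] at this
    exact this
  · intro x y z f g h
    exact comp_unit f g h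

theorem hom_induction' {motive : ∀ {x y : O}, (free 𝒞).Hom x y → Prop}
    (id : ∀ x : O, motive ((free 𝒞).id x))
    (unit : ∀ {x y : O} (q : 𝒞.Hom x y), motive (unit q))
    (comp : ∀ {x y z : O} (p : (free 𝒞).Hom x y) (q : (free 𝒞).Hom y z), motive p → motive q →
      motive ((free 𝒞).comp p q))
    {x y : O} (p : (free 𝒞).Hom x y) : motive p :=
  hom_induction id (fun p q h => comp p _ h (unit q)) p

end free

/-! ### The free resolution of a finite linear order -/

section Chain

variable {I : Type w} [LinearOrder I]

/-- A chain of `m` nested subsets of the interval `[i, j]` which contain the endpoints. -/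
@[ext]
structure Chain (m : ℕ) (i j : I) : Type w where
  set : Fin m → Set I
  mono : Monotone set
  le : i ≤ j
  left : ∀ s, i ∈ set s
  right : ∀ s, j ∈ set s
  bdd : ∀ s, set s ⊆ Set.Icc i j

namespace Chain

variable {m n : ℕ} {i j k : I}

/-- The trivial chain. -/
@[simps]
def id (m : ℕ) (i : I) : Chain m i i where
  set _ := {i}
  mono _ _ _ := le_rfl
  le := le_rfl
  left _ := rfl
  right _ := rfl
  bdd _ := by simp

/-- Concatenation of chains. -/
@[simps]
def comp (S : Chain m i j) (T : Chain m j k) : Chain m i k where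
  set s := S.set s ∪ T.set s
  mono _ _ h := Set.union_subset_union (S.mono h) (T.mono h)
  le := S.le.trans T.le
  left s := Or.inl (S.left s)
  right s := Or.inr (T.right s)
  bdd s := Set.union_subset ((S.bdd s).trans (Set.Icc_subset_Icc_right T.le))
    ((T.bdd s).trans (Set.Icc_subset_Icc_left S.le))

theorem id_comp (S : Chain m i j) : (id m i).comp S = S :=
  Chain.ext (funext fun s => Set.union_eq_right.2 (by simpa using S.left s))

theorem comp_id (S : Chain m i j) : S.comp (id m j) = S :=
  Chain.ext (funext fun s => Set.union_eq_left.2 (by simpa using S.right s))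

/-- The two parts lie on either side of `j` and both contain it, so they are recovered from the
union as its traces on the two intervals. -/
theorem comp_inj {S S' : Chain m i j} {T T' : Chain m j k} (h : S.comp T = S'.comp T') :
    S = S' ∧ T = T' := by
  have h' (s) : S.set s ∪ T.set s = S'.set s ∪ T'.set s := congrFun (congrArg Chain.set h) s
  constructor
  · ext s x
    have := Set.ext_iff.1 (h' s) x
    have h1 := S.bdd s
    have h2 := S'.bdd s
    have h3 := T.bdd s
    have h4 := T'.bdd s
    have h5 := S.right s
    have h6 := S'.right s
    constructor
    · intro hx
      rcases this.1 (Or.inl hx) with h | h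
      · exact h
      · rwa [le_antisymm (h1 hx).2 (h4 h).1]
    · intro hx
      rcases this.2 (Or.inl hx) with h | h
      · exact h
      · rwa [le_antisymm (h2 hx).2 (h3 h).1]
  · ext s x
    have := Set.ext_iff.1 (h' s) x
    have h1 := S.bdd s
    have h2 := S'.bdd s
    have h3 := T.bdd s
    have h4 := T'.bdd s
    have h5 := T.left s
    have h6 := T'.left s
    constructor
    · intro hx
      rcases this.1 (Or.inr hx) with h | h
      · rwa [le_antisymm (h2 h).2 (h3 hx).1]
      · exact h
    · intro hx
      rcases this.2 (Or.inr hx) with h | h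
      · rwa [le_antisymm (h1 h).2 (h4 hx).1]
      · exact h

theorem eq_id (S : Chain m i i) : S = id m i := by
  ext s x
  have := S.bdd s
  have h' := S.left s
  rw [Set.Icc_self] at this
  exact ⟨fun h => this h, fun h => by rw [id_set, Set.mem_singleton_iff] at h; rwa [h]⟩

/-- The chain obtained by adding the smallest possible set. -/
@[simps]
def cons (S : Chain m i j) : Chain (m + 1) i j where
  set := Fin.cons {i, j} S.set
  mono := by
    intro a b h
    induction b using Fin.cases with
    | zero =>
      obtain rfl := Fin.le_zero_iff.1 h
      exact le_rfl
    | succ b =>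
      induction a using Fin.cases with
      | zero => simpa [Set.insert_subset_iff] using ⟨S.left b, S.right b⟩
      | succ a => simpa using S.mono (Fin.succ_le_succ_iff.1 h)
  le := S.le
  left := Fin.cases (by simp) (by simpa using S.left)
  right := Fin.cases (by simp) (by simpa using S.right)
  bdd := Fin.cases (by simpa [Set.insert_subset_iff] using S.le) (by simpa using S.bdd)

theorem cons_id : (id m i).cons = id (m + 1) i := eq_id _

/-- The action of monotone maps on the indices of chains. -/
@[simps]
def op (α : Fin m →o Fin n) (S : Chain n i j) : Chain m i j where
  set s := S.set (α s)
  mono _ _ h := S.mono (α.monotone h)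
  le := S.le
  left _ := S.left _
  right _ := S.right _
  bdd _ := S.bdd _

/-- The image of a chain under a monotone map. -/
@[simps]
def map {J : Type w} [LinearOrder J] (f : I → J) (hf : Monotone f) (S : Chain m i j) :
    Chain m (f i) (f j) where
  set s := f '' S.set s
  mono _ _ h := Set.image_mono (S.mono h)
  le := hf S.le
  left s := ⟨_, S.left s, rfl⟩
  right s := ⟨_, S.right s, rfl⟩
  bdd s := by
    rintro _ ⟨x, hx, rfl⟩
    exact ⟨hf (S.bdd s hx).1, hf (S.bdd s hx).2⟩

/-- The first part of a chain, up to an element of all its members. -/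
@[simps]
def before (S : Chain m i j) (t : I) (h : i ≤ t) (ht : ∀ s, t ∈ S.set s) : Chain m i t where
  set s := S.set s ∩ Set.Iic t
  mono _ _ h := Set.inter_subset_inter_left _ (S.mono h)
  le := h
  left s := ⟨S.left s, h⟩
  right s := ⟨ht s, le_rfl⟩
  bdd s _ hx := ⟨(S.bdd s hx.1).1, hx.2⟩

/-- The last part of a chain, from an element of all its members. -/
@[simps]
def after (S : Chain m i j) (t : I) (h : t ≤ j) (ht : ∀ s, t ∈ S.set s) : Chain m t j where
  set s := S.set s ∩ Set.Ici t
  mono _ _ h := Set.inter_subset_inter_left _ (S.mono h)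
  le := h
  left s := ⟨ht s, le_rfl⟩
  right s := ⟨S.right s, h⟩
  bdd s _ hx := ⟨hx.2, (S.bdd s hx.1).2⟩

theorem before_comp_after (S : Chain m i j) (t : I) (h : i ≤ t) (h' : t ≤ j)
    (ht : ∀ s, t ∈ S.set s) : (S.before t h ht).comp (S.after t h' ht) = S := by
  ext s x
  have := le_total x t
  simp only [comp_set, before_set, after_set, Set.mem_union, Set.mem_inter_iff, Set.mem_Iic,
    Set.mem_Ici]
  tauto

theorem mem_of_mem_zero (S : Chain (m + 1) i j) {t : I} (ht : t ∈ S.set 0) (s) : t ∈ S.set s :=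
  S.mono (Fin.zero_le s) ht

/-- The chain without its smallest member. -/
abbrev tail (S : Chain (m + 1) i j) : Chain m i j :=
  S.op ⟨Fin.succ, fun _ _ h => Fin.succ_le_succ_iff.2 h⟩

theorem cons_tail (S : Chain (m + 1) i j) (h : S.set 0 = {i, j}) : S.tail.cons = S := by
  ext s
  induction s using Fin.cases with
  | zero => simp [h]
  | succ s => rfl

end Chain

/-- The category of chains of `m` subsets. -/
@[reducible]
def chainCat (I : Type w) [LinearOrder I] (m : ℕ) : Category.{w} I where
  Hom i j := Chain m i j
  id i := Chain.id m i
  comp S T := S.comp T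
  id_comp := Chain.id_comp
  comp_id := Chain.comp_id
  assoc _ _ _ := Chain.ext (funext fun _ => Set.union_assoc _ _ _)

/-- The functor from `(FU)ᵐ I` to the category of chains of `m` subsets. -/
def toChain (I : Type w) [LinearOrder I] : (m : ℕ) →
    FunctorOver (fun i : I => i) (iter I m) (chainCat I m)
  | 0 => ⟨fun p => ⟨Fin.elim0, fun s => s.elim0, leOfHom p, fun s => s.elim0, fun s => s.elim0,
      fun s => s.elim0⟩, fun _ => Chain.ext (funext fun s => s.elim0),
      fun _ _ => Chain.ext (funext fun s => s.elim0)⟩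
  | m + 1 => free.lift (fun i => i) (fun p => ((toChain I m).map p).cons)
      (fun i => by
        change Chain.cons ((toChain I m).map ((iter I m).id i)) = _
        rw [(toChain I m).map_id]; exact Chain.cons_id)

instance {i j : I} : Subsingleton (Chain 0 i j) :=
  ⟨fun _ _ => Chain.ext (funext fun s => s.elim0)⟩

/-- The chain of subsets corresponding to a morphism of `(FU)ᵐ I`. -/
def chainOf {m : ℕ} {i j : I} (p : (iter I m).Hom i j) : Chain m i j := (toChain I m).map p

theorem chainOf_id {m : ℕ} (i : I) : chainOf ((iter I m).id i) = Chain.id m i :=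
  (toChain I m).map_id i

theorem chainOf_comp {m : ℕ} {i j k : I} (p : (iter I m).Hom i j) (q : (iter I m).Hom j k) :
    chainOf ((iter I m).comp p q) = (chainOf p).comp (chainOf q) :=
  (toChain I m).map_comp p q

theorem chainOf_unit {m : ℕ} {i j : I} (p : (iter I m).Hom i j) :
    chainOf (m := m + 1) (free.unit p) = (chainOf p).cons :=
  free.lift_unit _ _ _ p

theorem le_of_hom {m : ℕ} {i j : I} (p : (iter I m).Hom i j) : i ≤ j := (chainOf p).le

theorem chainOf_injective_zero {i j : I} (p q : (iter I 0).Hom i j) : p = q :=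
  Subsingleton.elim (α := (i ⟶ j)) p q

/-! ### Injectivity of the passage from arrows to chains -/

section

variable {m : ℕ} (ih : ∀ {i j : I} (p q : (iter I m).Hom i j), chainOf p = chainOf q → p = q)

include ih

/-- A string from `i` to `i` cannot leave `i`, and there is only one chain from `i` to `i`, so by
`ih` all its generators are identities. The equation `i = j` keeps the target free for the induction
on `p`. -/
theorem free_endo_eq_id_aux {i j : I} (p : (iter I (m + 1)).Hom i j) :
    ∀ h : i = j, p = h ▸ (iter I (m + 1)).id i := by
  induction p using free.hom_induction with
  | id x => intro h; rfl
  | @comp_unit x y z p q hp =>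
    intro h
    subst h
    have h1 : x = y := le_antisymm (le_of_hom (m := m + 1) p) (le_of_hom q)
    subst h1
    have h2 : q = (iter I m).id x := ih _ _ ((Chain.eq_id _).trans (Chain.eq_id _).symm)
    rw [hp rfl, h2, free.unit_id]
    exact (iter I (m + 1)).id_comp _

/-- Trailing generators that end where they start are identities and can be dropped. -/
theorem free_decomp_aux {i k : I} (p : (iter I (m + 1)).Hom i k) (h : i ≠ k) :
    ∃ (j : I) (p' : (iter I (m + 1)).Hom i j) (q : (iter I m).Hom j k), j ≠ k ∧
      p = (iter I (m + 1)).comp p' (free.unit q) := by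
  induction p using free.hom_induction with
  | id x => exact (h rfl).elim
  | @comp_unit x y z p q hp =>
    by_cases h1 : y = z
    · subst h1
      obtain ⟨j, p', q', hj, rfl⟩ := hp h
      refine ⟨j, p', q', hj, ?_⟩
      have h2 : q = (iter I m).id y := ih _ _ ((Chain.eq_id _).trans (Chain.eq_id _).symm)
      rw [h2, free.unit_id]
      exact (iter I (m + 1)).comp_id _
    · exact ⟨y, p, q, h1, rfl⟩

/-- The smallest set of the chain consists of the objects through which the string of generators
passes. Its largest element below `z` is the source of the last proper generator, which can
therefore be split off from both arrows. -/
theorem chainOf_injective_aux {i j : I} (p q : (iter I (m + 1)).Hom i j)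
    (h : chainOf p = chainOf q) : p = q := by
  induction p using free.hom_induction with
  | id x => exact (free_endo_eq_id_aux ih q rfl).symm
  | @comp_unit x y z p g hp =>
    by_cases h1 : y = z
    · subst h1
      have h2 : g = (iter I m).id y := ih _ _ ((Chain.eq_id _).trans (Chain.eq_id _).symm)
      have h3 : (free (iter I m)).comp p (free.unit g) = p := by
        rw [h2, free.unit_id]
        exact (iter I (m + 1)).comp_id _
      rw [h3] at h ⊢
      exact hp _ h
    · have hxy := le_of_hom (m := m + 1) p
      have hyz := lt_of_le_of_ne (le_of_hom g) h1
      obtain ⟨y', p', g', h1', rfl⟩ := free_decomp_aux ih q (hxy.trans_lt hyz).ne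
      have hyz' := lt_of_le_of_ne (le_of_hom g') h1'
      have key : ∀ {y : I} (p : (iter I (m + 1)).Hom x y) (g : (iter I m).Hom y z),
          chainOf (m := m + 1) ((iter I (m + 1)).comp p (free.unit g)) =
            (chainOf p).comp (chainOf g).cons := fun p g => by
        rw [← chainOf_unit]
        exact chainOf_comp _ _
      have h' := ((key p g).symm.trans h).trans (key p' g')
      have h0 := congrFun (congrArg Chain.set h') 0
      -- The generator `g'` contributes only `y'` and `z` to the smallest set, so any element of it
      -- below `z` is at most `y'`.
      have aux : ∀ {y y' : I} (p : (iter I (m + 1)).Hom x y) (g : (iter I m).Hom y z)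
          (p' : (iter I (m + 1)).Hom x y') (g' : (iter I m).Hom y' z) (_ : y < z)
          (_ : ((chainOf p).comp (chainOf g).cons).set 0 =
            ((chainOf p').comp (chainOf g').cons).set 0), y ≤ y' := by
        intro y y' p g p' g' hy h
        have : y ∈ ((chainOf p).comp (chainOf g).cons).set 0 := Or.inl (Chain.right _ 0)
        rw [h] at this
        rcases this with this | this
        · exact (Chain.bdd _ _ this).2
        · simp only [Chain.cons_set, Fin.cons_zero, Set.mem_insert_iff,
            Set.mem_singleton_iff] at this
          rcases this with this | this
          · exact this.le
          · exact (hy.ne this).elim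
      obtain rfl : y = y' := le_antisymm (aux p g p' g' hyz h0) (aux p' g' p g hyz' h0.symm)
      obtain ⟨h2, h3⟩ := Chain.comp_inj h'
      rw [hp _ h2]
      have h4 : g = g' := by
        refine ih _ _ (Chain.ext (funext fun s => ?_))
        simpa using congrFun (congrArg Chain.set h3) s.succ
      rw [h4]

end

theorem chainOf_injective {m : ℕ} {i j : I} {p q : (iter I m).Hom i j}
    (h : chainOf p = chainOf q) : p = q := by
  induction m generalizing i j with
  | zero => exact chainOf_injective_zero p q
  | succ m ih => exact chainOf_injective_aux (fun _ _ => ih) p q h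

/-- The chain is cut at the largest element `y` below `j` of its smallest set. The part before `y`
has a smaller target; the part after `y` has smallest set `{y, j}`, so it is a single generator
given by a chain one level lower. -/
theorem exists_chainOf_eq [Finite I] {m : ℕ} {i j : I} (T : Chain m i j) :
    ∃ p : (iter I m).Hom i j, chainOf p = T := by
  induction m generalizing i j with
  | zero => exact ⟨homOfLE T.le, Subsingleton.elim _ _⟩
  | succ m ih =>
    induction j using WellFoundedLT.induction with
    | ind j hj =>
      by_cases hij : i = j
      · subst hij
        exact ⟨(iter I (m + 1)).id i, (chainOf_id i).trans (Chain.eq_id _).symm⟩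
      · obtain ⟨y, ⟨hy1, hy2⟩, hy3⟩ := Set.exists_max_image {t | t ∈ T.set 0 ∧ t < j} _root_.id
          (Set.toFinite _) ⟨i, T.left 0, lt_of_le_of_ne T.le hij⟩
        have hy := T.mem_of_mem_zero hy1
        obtain ⟨p, hp⟩ := hj y hy2 (T.before y (T.bdd 0 hy1).1 hy)
        obtain ⟨q, hq⟩ := ih (T.after y hy2.le hy).tail
        refine ⟨(iter I (m + 1)).comp p (free.unit q), ?_⟩
        refine (chainOf_comp p (free.unit q)).trans ?_
        rw [chainOf_unit, hp, hq, Chain.cons_tail]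
        · exact T.before_comp_after y _ _ hy
        · ext t
          simp only [Chain.after_set, Set.mem_inter_iff, Set.mem_Ici, Set.mem_insert_iff,
            Set.mem_singleton_iff]
          constructor
          · rintro ⟨h1, h2⟩
            rcases (T.bdd 0 h1).2.lt_or_eq with h3 | h3
            · exact Or.inl (le_antisymm (hy3 t ⟨h1, h3⟩) h2)
            · exact Or.inr h3
          · rintro (rfl | rfl)
            · exact ⟨hy1, le_rfl⟩
            · exact ⟨T.right 0, hy2.le⟩

/-- The morphism of `(FU)ᵐ I` corresponding to a chain of `m` subsets. -/
noncomputable def ofChain [Finite I] {m : ℕ} {i j : I} (T : Chain m i j) : (iter I m).Hom i j :=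
  (exists_chainOf_eq T).choose

@[simp]
theorem chainOf_ofChain [Finite I] {m : ℕ} {i j : I} (T : Chain m i j) :
    chainOf (ofChain T) = T :=
  (exists_chainOf_eq T).choose_spec

@[simp]
theorem ofChain_chainOf [Finite I] {m : ℕ} {i j : I} (p : (iter I m).Hom i j) :
    ofChain (chainOf p) = p :=
  chainOf_injective (chainOf_ofChain _)

theorem chainOf_counit {m : ℕ} {i j : I} (p : (iter I (m + 1)).Hom i j) :
    chainOf ((free.counit (iter I m)).map p) = (chainOf p).tail := by
  induction p using free.hom_induction' with
  | id x =>
    rw [(free.counit (iter I m)).map_id]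
    exact (Chain.eq_id _).trans (Chain.eq_id _).symm
  | unit q => rw [free.counit_unit, chainOf_unit]; rfl
  | comp p q hp hq =>
    rw [(free.counit (iter I m)).map_comp, chainOf_comp, hp, hq]
    refine Eq.trans ?_ (congrArg Chain.tail (chainOf_comp (m := m + 1) p q).symm)
    rfl

/-- The index `0` stands for the outermost parentheses and for the smallest set. The counit forgets
this set and the comultiplication repeats it, just as reindexing along `α` does. -/
theorem chainOf_op {m n : ℕ} (α : Fin m →o Fin n) {i j : I} (p : (iter I n).Hom i j) :
    chainOf ((op I m n α).map p) = (chainOf p).op α := by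
  induction m generalizing n i j with
  | zero => exact Subsingleton.elim _ _
  | succ m ihm =>
    induction n generalizing i j with
    | zero => exact (α 0).elim0
    | succ n ihn =>
      by_cases h : α 0 = 0
      · rw [op_of_eq α h]
        induction p using free.hom_induction' with
        | id x =>
          rw [(free.comult (iter I n)).map_id, FunctorOver.map_id]
          exact (Chain.eq_id _).trans (Chain.eq_id _).symm
        | unit q =>
          rw [free.comult_unit, free.map_unit]
          refine (chainOf_unit _).trans ?_
          rw [ihm, chainOf_unit]
          ext s : 2
          induction s using Fin.cases with
          | zero => simp [h]
          | succ s => rfl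
        | comp p q hp hq =>
          rw [(free.comult (iter I n)).map_comp, FunctorOver.map_comp]
          refine (chainOf_comp _ _).trans ?_
          rw [hp, hq]
          refine Eq.trans ?_ (congrArg (Chain.op α) (chainOf_comp (m := n + 1) p q).symm)
          rfl
      · rw [op_of_ne α h, ihn, chainOf_counit]
        ext s : 2
        exact congrArg (chainOf p).set (Fin.succ_pred (α s) (ne_zero α h s))

theorem chainOf_iterMap {J : Type w} [LinearOrder J] {f : I → J} (hf : Monotone f) {m : ℕ}
    {i j : I} (p : (iter I m).Hom i j) :
    chainOf ((iterMap hf.functor m).map p) = (chainOf p).map f hf := by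
  induction m generalizing i j with
  | zero => exact Subsingleton.elim (α := Chain 0 (f i) (f j)) _ _
  | succ m ih =>
    change chainOf (m := m + 1) ((free.map (iterMap hf.functor m)).map p) = _
    induction p using free.hom_induction' with
    | id x =>
      rw [FunctorOver.map_id]
      exact (Chain.eq_id (i := f x) _).trans (Chain.eq_id _).symm
    | unit q =>
      rw [free.map_unit]
      refine (chainOf_unit _).trans ?_
      rw [ih, chainOf_unit]
      refine Chain.ext (funext fun s => ?_)
      induction s using Fin.cases with
      | zero => simp [Set.image_pair]
      | succ s => rfl
    | comp p q hp hq =>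
      rw [FunctorOver.map_comp]
      refine (chainOf_comp _ _).trans ?_
      rw [hp, hq]
      refine Eq.trans ?_ (congrArg (Chain.map f hf) (chainOf_comp (m := m + 1) p q).symm)
      exact Chain.ext (funext fun s => (Set.image_union _ _ _).symm)

end Chain

/-! ### Coherent diagrams in terms of arrows -/

section

variable {S : Type u} [EnrichedCategory SSet.{w} S]

/-- The `n`-simplices of the mapping spaces of a simplicial category. -/
abbrev SHom (n : SimplexCategory) (X Y : S) : Type w :=
  (EnrichedCategory.Hom X Y : SSet.{w}).obj (Opposite.op n)

namespace SHom

variable {m n : SimplexCategory} {X Y Z W : S}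

/-- The identity `n`-arrow. -/
def id (n : SimplexCategory) (X : S) : SHom n X X :=
  (eId SSet.{w} X).app (Opposite.op n) PUnit.unit

/-- A pair of composable `n`-arrows. -/
abbrev pair (f : SHom n X Y) (g : SHom n Y Z) :
    ((EnrichedCategory.Hom X Y : SSet.{w}) ⊗ (EnrichedCategory.Hom Y Z : SSet.{w})).obj
      (Opposite.op n) :=
  ((f, g) : SHom n X Y × SHom n Y Z)

/-- Composition of `n`-arrows. -/
def comp (f : SHom n X Y) (g : SHom n Y Z) : SHom n X Z :=
  (eComp SSet.{w} X Y Z).app (Opposite.op n) (pair f g)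

/-- The action of simplicial operators on arrows. -/
def op (α : m ⟶ n) (f : SHom n X Y) : SHom m X Y :=
  (EnrichedCategory.Hom X Y : SSet.{w}).map α.op f

theorem id_comp (f : SHom n X Y) : (id n X).comp f = f := by
  have := congrArg (fun φ => φ.app (Opposite.op n) f) (e_id_comp SSet.{w} X Y)
  exact this

theorem comp_id (f : SHom n X Y) : f.comp (id n Y) = f := by
  have := congrArg (fun φ => φ.app (Opposite.op n) f) (e_comp_id SSet.{w} X Y)
  exact this

theorem assoc (f : SHom n X Y) (g : SHom n Y Z) (h : SHom n Z W) :
    (f.comp g).comp h = f.comp (g.comp h) := by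
  have := congrArg (fun φ => φ.app (Opposite.op n) (f, g, h)) (e_assoc SSet.{w} X Y Z W)
  exact this

theorem op_comp (α : m ⟶ n) (f : SHom n X Y) (g : SHom n Y Z) :
    op α (f.comp g) = (op α f).comp (op α g) :=
  (ConcreteCategory.congr_hom ((eComp SSet.{w} X Y Z).naturality α.op) (pair f g)).symm

/-- Transport of arrows along equalities of objects. -/
def cast {X' Y' : S} (hX : X = X') (hY : Y = Y') (f : SHom n X Y) : SHom n X' Y' :=
  hX ▸ hY ▸ f

theorem cast_id {X' : S} (hX : X = X') : cast hX hX (id n X) = id n X' := by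
  subst hX; rfl

theorem cast_comp {X' Y' Z' : S} (hX : X = X') (hY : Y = Y') (hZ : Z = Z') (f : SHom n X Y)
    (g : SHom n Y Z) : cast hX hZ (f.comp g) = (cast hX hY f).comp (cast hY hZ g) := by
  subst hX hY hZ; rfl

theorem cast_op {X' Y' : S} (hX : X = X') (hY : Y = Y') (α : m ⟶ n) (f : SHom n X Y) :
    cast hX hY (op α f) = op α (cast hX hY f) := by
  subst hX hY; rfl

theorem cast_cast {X' Y' X'' Y'' : S} (hX : X = X') (hY : Y = Y') (hX' : X' = X'')
    (hY' : Y' = Y'') (f : SHom n X Y) :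
    cast hX' hY' (cast hX hY f) = cast (hX.trans hX') (hY.trans hY') f := by
  subst hX hY hX' hY'; rfl

end SHom

namespace CoherentDiagram

variable {A : Type w} [SmallCategory A]

/-- The action of a coherent diagram on the objects of its shape. -/
def onObj (F : CoherentDiagram A S) (x : A) : S := F.obj ⟨x⟩

/-- The action of a coherent diagram on arrows. -/
def onHom (F : CoherentDiagram A S) (n : SimplexCategory) {x y : A}
    (p : (iter A (n.len + 1)).Hom x y) : SHom n (F.onObj x) (F.onObj y) :=
  (F.map ⟨x⟩ ⟨y⟩).app (Opposite.op n) p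

theorem onHom_id (F : CoherentDiagram A S) (n : SimplexCategory) (x : A) :
    F.onHom n ((iter A (n.len + 1)).id x) = SHom.id n (F.onObj x) := by
  have := congrArg (fun φ => φ.app (Opposite.op n) PUnit.unit) (F.map_id ⟨x⟩)
  exact this

theorem onHom_comp (F : CoherentDiagram A S) (n : SimplexCategory) {x y z : A}
    (p : (iter A (n.len + 1)).Hom x y) (q : (iter A (n.len + 1)).Hom y z) :
    F.onHom n ((iter A (n.len + 1)).comp p q) = (F.onHom n p).comp (F.onHom n q) := by
  have := congrArg (fun φ => φ.app (Opposite.op n) (p, q)) (F.map_comp ⟨x⟩ ⟨y⟩ ⟨z⟩)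
  exact this

theorem onHom_op (F : CoherentDiagram A S) {m n : SimplexCategory} (α : m ⟶ n) {x y : A}
    (p : (iter A (n.len + 1)).Hom x y) :
    F.onHom m ((op A _ _ α.toOrderHom).map p) = SHom.op α (F.onHom n p) :=
  ConcreteCategory.congr_hom ((F.map ⟨x⟩ ⟨y⟩).naturality α.op) p

/-- Constructor for coherent diagrams. -/
def ofData (obj : A → S)
    (map : ∀ (n : SimplexCategory) {x y : A}, (iter A (n.len + 1)).Hom x y →
      SHom n (obj x) (obj y))
    (map_id : ∀ (n : SimplexCategory) (x : A),
      map n ((iter A (n.len + 1)).id x) = SHom.id n (obj x))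
    (map_comp : ∀ (n : SimplexCategory) {x y z : A} (p : (iter A (n.len + 1)).Hom x y)
      (q : (iter A (n.len + 1)).Hom y z),
      map n ((iter A (n.len + 1)).comp p q) = (map n p).comp (map n q))
    (map_op : ∀ {m n : SimplexCategory} (α : m ⟶ n) {x y : A}
      (p : (iter A (n.len + 1)).Hom x y),
      map m ((op A _ _ α.toOrderHom).map p) = SHom.op α (map n p)) : CoherentDiagram A S where
  obj x := obj x.as
  map x y :=
    { app n := ↾fun p => map n.unop p
      naturality _ _ α := by
        ext p
        exact map_op α.unop p }
  map_id x := by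
    ext n _
    exact map_id n.unop x.as
  map_comp x y z := by
    ext n p
    exact map_comp n.unop p.1 p.2

theorem onHom_restrict {B : Type w} [SmallCategory B] (H : A ⥤ B) (F : CoherentDiagram B S)
    (n : SimplexCategory) {x y : A} (p : (iter A (n.len + 1)).Hom x y) :
    (F.restrict H).onHom n p = F.onHom n ((iterMap H _).map p) := rfl

theorem ext_of_onHom {F G : CoherentDiagram A S} (hobj : ∀ x, F.onObj x = G.onObj x)
    (hmap : ∀ (n : SimplexCategory) (x y : A) (p : (iter A (n.len + 1)).Hom x y),
      SHom.cast (hobj x) (hobj y) (F.onHom n p) = G.onHom n p) : F = G := by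
  obtain ⟨Fo, Fm, _, _⟩ := F
  obtain ⟨Go, Gm, _, _⟩ := G
  obtain rfl : Fo = Go := funext fun x => hobj x.as
  obtain rfl : Fm = Gm := by
    funext x y
    ext n p
    exact hmap n.unop x.as y.as p
  rfl

theorem onObj_congr {F G : CoherentDiagram A S} (h : F = G) (x : A) : F.onObj x = G.onObj x := by
  rw [h]

theorem onHom_congr {F G : CoherentDiagram A S} (h : F = G) (n : SimplexCategory) {x y : A}
    (p : (iter A (n.len + 1)).Hom x y) :
    SHom.cast (onObj_congr h x) (onObj_congr h y) (F.onHom n p) = G.onHom n p := by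
  subst h; rfl

end CoherentDiagram

end

/-! ### Compatible families of coherent diagrams -/

section

open Simplicial

/-- The functor between finite ordinals given by a morphism in the simplex category. -/
abbrev finFunctor {m n : SimplexCategory} (α : m ⟶ n) : Fin (m.len + 1) ⥤ Fin (n.len + 1) :=
  α.toOrderHom.monotone.functor

variable (B : Type*) [Category* B] (S : Type u) [EnrichedCategory SSet.{w} S]

/-- A family of coherent diagrams of shapes `[n]` which is indexed by a simplicial subset of the
nerve of `B` that contains all vertices. -/
structure DiagramFamily where
  mem : ∀ n : SimplexCategory, (Fin (n.len + 1) ⥤ B) → Prop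
  mem_comp : ∀ {m n : SimplexCategory} (α : m ⟶ n) {σ : Fin (n.len + 1) ⥤ B}, mem n σ →
    mem m (finFunctor α ⋙ σ)
  mem_const : ∀ x : B, mem ⦋0⦌ ((Functor.const _).obj x)
  diag : ∀ {n : SimplexCategory} {σ : Fin (n.len + 1) ⥤ B}, mem n σ →
    CoherentDiagram (Ord.{w} n) S
  diag_comp : ∀ {m n : SimplexCategory} (α : m ⟶ n) {σ : Fin (n.len + 1) ⥤ B} (h : mem n σ),
    diag (mem_comp α h) = (diag h).restrict (ordFunctor α)

namespace DiagramFamily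

variable {B S} (Φ : DiagramFamily.{w} B S) {m n k : SimplexCategory}

theorem diag_congr {σ τ : Fin (n.len + 1) ⥤ B} (e : σ = τ) (h : Φ.mem n σ) :
    Φ.diag h = Φ.diag (e ▸ h) := by
  subst e; rfl

/-- The object corresponding to a vertex. -/
def obj (x : B) : S := (Φ.diag (Φ.mem_const x)).onObj ⟨0⟩

theorem const_comp (σ : Fin (n.len + 1) ⥤ B) (i : Fin (n.len + 1)) :
    finFunctor (SimplexCategory.const ⦋0⦌ n i) ⋙ σ = (Functor.const _).obj (σ.obj i) :=
  Functor.hext (fun _ => rfl) fun a b f => by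
    obtain rfl : a = b := Subsingleton.elim (α := Fin 1) a b
    obtain rfl : f = 𝟙 _ := Subsingleton.elim _ _
    exact heq_of_eq (CategoryTheory.Functor.map_id _ _)

/-- This is compatibility with the inclusion of a vertex. The equality of objects is only
propositional, which is why values on arrows are transported by `SHom.cast`. -/
theorem onObj_diag {σ : Fin (n.len + 1) ⥤ B} (h : Φ.mem n σ) (i : Ord.{w} n) :
    (Φ.diag h).onObj i = Φ.obj (σ.obj i.down) := by
  have h1 := Φ.diag_comp (SimplexCategory.const ⦋0⦌ n i.down) h
  rw [Φ.diag_congr (const_comp σ i.down)] at h1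
  exact (CoherentDiagram.onObj_congr h1 ⟨0⟩).symm

/-- The value of a family of coherent diagrams on an arrow. -/
def val {σ : Fin (n.len + 1) ⥤ B} (h : Φ.mem n σ) (m : SimplexCategory) {i j : Ord.{w} n}
    (p : (iter (Ord.{w} n) (m.len + 1)).Hom i j) :
    SHom m (Φ.obj (σ.obj i.down)) (Φ.obj (σ.obj j.down)) :=
  SHom.cast (Φ.onObj_diag h i) (Φ.onObj_diag h j) ((Φ.diag h).onHom m p)

variable {σ : Fin (n.len + 1) ⥤ B} (h : Φ.mem n σ)

theorem val_id (m : SimplexCategory) (i : Ord.{w} n) :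
    Φ.val h m ((iter (Ord.{w} n) (m.len + 1)).id i) = SHom.id m _ := by
  rw [val, CoherentDiagram.onHom_id, SHom.cast_id]

theorem val_comp (m : SimplexCategory) {i j k : Ord.{w} n}
    (p : (iter (Ord.{w} n) (m.len + 1)).Hom i j) (q : (iter (Ord.{w} n) (m.len + 1)).Hom j k) :
    Φ.val h m ((iter (Ord.{w} n) (m.len + 1)).comp p q) = (Φ.val h m p).comp (Φ.val h m q) := by
  rw [val, CoherentDiagram.onHom_comp, SHom.cast_comp]; rfl

theorem val_op {l m : SimplexCategory} (α : l ⟶ m) {i j : Ord.{w} n}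
    (p : (iter (Ord.{w} n) (m.len + 1)).Hom i j) :
    Φ.val h l ((op _ _ _ α.toOrderHom).map p) = SHom.op α (Φ.val h m p) := by
  rw [val, CoherentDiagram.onHom_op, SHom.cast_op]; rfl

theorem val_map (α : k ⟶ n) (m : SimplexCategory) {i j : Ord.{w} k}
    (p : (iter (Ord.{w} k) (m.len + 1)).Hom i j) :
    Φ.val (Φ.mem_comp α h) m p = Φ.val h m ((iterMap (ordFunctor α) _).map p) := by
  have h1 := CoherentDiagram.onHom_congr (Φ.diag_comp α h) m p
  rw [CoherentDiagram.onHom_restrict] at h1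
  unfold val
  rw [← h1]
  exact (SHom.cast_cast _ _ _ _ _).symm

/-- The value of a family of coherent diagrams on a chain. -/
noncomputable def cval (m : SimplexCategory) {i j : Ord.{w} n} (T : Chain (m.len + 1) i j) :
    SHom m (Φ.obj (σ.obj i.down)) (Φ.obj (σ.obj j.down)) :=
  Φ.val h m (ofChain T)

theorem cval_chainOf (m : SimplexCategory) {i j : Ord.{w} n}
    (p : (iter (Ord.{w} n) (m.len + 1)).Hom i j) : Φ.cval h m (chainOf p) = Φ.val h m p := by
  rw [cval, ofChain_chainOf]

theorem cval_id (m : SimplexCategory) (i : Ord.{w} n) :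
    Φ.cval h m (Chain.id _ i) = SHom.id m _ := by
  rw [← chainOf_id, cval_chainOf, val_id]

theorem cval_comp (m : SimplexCategory) {i j k : Ord.{w} n}
    (T : Chain (m.len + 1) i j) (T' : Chain (m.len + 1) j k) :
    Φ.cval h m (T.comp T') = (Φ.cval h m T).comp (Φ.cval h m T') := by
  obtain ⟨p, rfl⟩ := exists_chainOf_eq T
  obtain ⟨q, rfl⟩ := exists_chainOf_eq T'
  rw [← chainOf_comp, cval_chainOf, cval_chainOf, cval_chainOf, val_comp]

theorem cval_op {l m : SimplexCategory} (α : l ⟶ m) {i j : Ord.{w} n}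
    (T : Chain (m.len + 1) i j) :
    Φ.cval h l (T.op α.toOrderHom) = SHom.op α (Φ.cval h m T) := by
  obtain ⟨p, rfl⟩ := exists_chainOf_eq T
  rw [← chainOf_op, cval_chainOf, cval_chainOf, val_op]

/-- The map of lifted ordinals underlying a morphism of the simplex category. -/
abbrev ordMap (α : k ⟶ n) : Ord.{w} k → Ord.{w} n := α.toOrderHom.uliftMap

theorem ordMap_monotone (α : k ⟶ n) : Monotone (ordMap.{w} α) := α.toOrderHom.uliftMap.monotone

theorem cval_map (α : k ⟶ n) (m : SimplexCategory) {i j : Ord.{w} k}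
    (T : Chain (m.len + 1) i j) :
    Φ.cval (Φ.mem_comp α h) m T = Φ.cval h m (T.map (ordMap α) (ordMap_monotone α)) := by
  obtain ⟨p, rfl⟩ := exists_chainOf_eq T
  rw [cval_chainOf, val_map, ← cval_chainOf]
  exact congrArg _ (chainOf_iterMap (ordMap_monotone α) p)

/-- Two chains with the same members have values which differ by a transport only. -/
theorem cval_congr {τ : Fin (n.len + 1) ⥤ B} (e : σ = τ) (m : SimplexCategory)
    {i j i' j' : Ord.{w} n} (T : Chain (m.len + 1) i j) (T' : Chain (m.len + 1) i' j')
    (hi : i = i') (hj : j = j') (hT : T.set = T'.set) :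
    SHom.cast (by rw [e, hi]) (by rw [e, hj]) (Φ.cval h m T) = Φ.cval (e ▸ h) m T' := by
  subst e hi hj
  obtain rfl := Chain.ext hT
  rfl

end DiagramFamily

end

/-! ### Lifting arrows of the free resolution to simplices of the nerve -/

section

open Simplicial

/-- A morphism of a category together with its source and target. -/
abbrev Arr {O : Type w} (𝒞 : Category.{w} O) : Type w := Σ x y : O, 𝒞.Hom x y

/-- The bundled version of a morphism. -/
abbrev arr {O : Type w} {𝒞 : Category.{w} O} {x y : O} (p : 𝒞.Hom x y) : Arr 𝒞 := ⟨x, y, p⟩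

theorem arr_comp_congr {O : Type w} {𝒞 : Category.{w} O} {x y z x' y' z' : O} {p : 𝒞.Hom x y}
    {q : 𝒞.Hom y z} {p' : 𝒞.Hom x' y'} {q' : 𝒞.Hom y' z'} (hp : arr p = arr p')
    (hq : arr q = arr q') : arr (𝒞.comp p q) = arr (𝒞.comp p' q') := by
  cases hp; cases hq; rfl

variable {B : Type w} [SmallCategory B]

/-- The functor from the lifted ordinal given by a simplex of the nerve. -/
abbrev ordSimplex {n : SimplexCategory} (σ : Fin (n.len + 1) ⥤ B) : Ord.{w} n ⥤ B :=
  ordDown n ⋙ σ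

theorem arr_iterMap_congr {A : Type w} [SmallCategory A] {H K : A ⥤ B} (h : H = K) {m : ℕ}
    {x y : A} (p : (iter A m).Hom x y) : arr ((iterMap H m).map p) = arr ((iterMap K m).map p) := by
  subst h; rfl

theorem precomp_map_zero_succ {l : ℕ} (τ : ComposableArrows B l) {x : B} (g : x ⟶ τ.obj 0)
    (j : Fin (l + 1)) :
    (τ.precomp g).map (homOfLE (Fin.zero_le j.succ)) = g ≫ τ.map (homOfLE (Fin.zero_le j)) := by
  induction j using Fin.cases with
  | zero =>
    refine Eq.trans ?_ (congrArg (fun f => g ≫ f) (τ.map_id 0)).symm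
    exact (Category.comp_id g).symm
  | succ j => rfl

theorem precomp_comp {l n : ℕ} (f : ⦋l + 1⦌ ⟶ ⦋n⦌) (ρ : ComposableArrows B n) :
    ComposableArrows.precomp (finFunctor (SimplexCategory.δ 0 ≫ f) ⋙ ρ)
      (ρ.map (homOfLE (f.toOrderHom.monotone (Fin.zero_le (Fin.succ 0))))) = finFunctor f ⋙ ρ := by
  refine ComposableArrows.ext_succ rfl rfl ?_
  exact ((Category.id_comp _).trans (Category.comp_id _)).symm

/-- Given an arrow of `(FU)ᵐ B` and a simplex of the nerve which starts at its target, the arrow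
can be lifted to an extension of the simplex. -/
theorem exists_lift {m : ℕ} {x y : B} (p : (iter B m).Hom x y) {l : ℕ} (τ : ComposableArrows B l)
    (hτ : τ.obj 0 = y) :
    ∃ (l' : ℕ) (ρ : ComposableArrows B l') (g : ⦋l⦌ ⟶ ⦋l'⦌)
      (p' : (iter (Ord.{w} ⦋l'⦌) m).Hom ⟨0⟩ ⟨g.toOrderHom 0⟩), finFunctor g ⋙ ρ = τ ∧
        arr ((iterMap (ordSimplex (n := ⦋l'⦌) ρ) m).map p') = arr p := by
  induction m generalizing x y l with
  | zero =>
    subst hτ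
    refine ⟨l + 1, τ.precomp p, SimplexCategory.δ 0, homOfLE (Fin.zero_le _), rfl, ?_⟩
    refine congrArg (fun f => (arr (𝒞 := iter B 0) f)) ?_
    exact (precomp_map_zero_succ τ p 0).trans ((congrArg _ (τ.map_id _)).trans (Category.comp_id _))
  | succ m ih =>
    induction p using free.hom_induction' generalizing l with
    | id x =>
      subst hτ
      exact ⟨l, τ, 𝟙 _, (iter _ (m + 1)).id _, rfl,
        congrArg (fun f => (arr (𝒞 := iter B (m + 1)) f)) (FunctorOver.map_id _ _)⟩
    | unit q =>
      obtain ⟨l', ρ, g, q', hg, hq⟩ := ih q τ hτ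
      refine ⟨l', ρ, g, free.unit q', hg, ?_⟩
      have := congrArg (fun f => (arr (𝒞 := iter B (m + 1)) (free.unit f.2.2))) hq
      refine Eq.trans ?_ this
      exact congrArg (fun f => (arr (𝒞 := iter B (m + 1)) f)) (free.map_unit _ _)
    | comp p q hp hq =>
      -- The second factor is lifted first. The first factor is then lifted to an extension `ρ₂` of
      -- the simplex `ρ₁`, so that both live in `ρ₂`.
      obtain ⟨l₁, ρ₁, g₁, q', hg₁, hq'⟩ := hq τ hτ
      obtain ⟨l₂, ρ₂, g₂, p', hg₂, hp'⟩ := hp ρ₁ (congrArg Sigma.fst hq')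
      refine ⟨l₂, ρ₂, g₁ ≫ g₂, (iter _ (m + 1)).comp p' ((iterMap (ordFunctor g₂) _).map q'),
        ?_, ?_⟩
      · rw [← hg₁, ← hg₂]; rfl
      · refine (congrArg (fun f => (arr (𝒞 := iter B (m + 1)) f))
          ((iterMap (ordSimplex (n := ⦋l₂⦌) ρ₂) (m + 1)).map_comp _ _)).trans ?_
        refine arr_comp_congr hp' ?_
        refine Eq.trans ?_ hq'
        refine (congrArg (fun f => (arr (𝒞 := iter B (m + 1)) f)) (iterMap_comp (ordFunctor g₂)
          (ordSimplex (n := ⦋l₂⦌) ρ₂) q').symm).trans ?_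
        refine arr_iterMap_congr ?_ q'
        rw [← hg₂]; rfl

/-! ### Marked strings -/

/-- A string of composable arrows from `x` to `z`, whose positions are marked by natural
numbers. -/
structure MarkedString (z x : B) : Type w where
  len : ℕ
  str : ComposableArrows B len
  first : str.obj 0 = x
  last : str.obj (Fin.last len) = z
  marks : ℕ → Set (Fin (len + 1))

namespace MarkedString

variable {z x y : B}

/-- The marked strings `s` and `t` are elementarily equivalent if the underlying simplex of `s` is
obtained from `t` by a simplicial operator which transforms the marks of `s` to those of `t`. -/
def Step (s t : MarkedString z x) : Prop :=
  ∃ f : ⦋s.len⦌ ⟶ ⦋t.len⦌, f.toOrderHom 0 = 0 ∧ f.toOrderHom (Fin.last s.len) = Fin.last t.len ∧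
    s.str = finFunctor f ⋙ t.str ∧ ∀ c, t.marks c = f.toOrderHom '' s.marks c

/-- Add an arrow at the beginning of a string. -/
def prepend (g : x ⟶ y) (s : MarkedString z y) : MarkedString z x where
  len := s.len + 1
  str := s.str.precomp (g ≫ eqToHom s.first.symm)
  first := rfl
  last := s.last
  marks c := Fin.succ '' s.marks c

/-- Mark the first object of a string. -/
def mark (c : ℕ) (s : MarkedString z x) : MarkedString z x where
  len := s.len
  str := s.str
  first := s.first
  last := s.last
  marks := Function.update s.marks c (insert 0 (s.marks c))

/-- The extension of a monotone map which preserves the new first element. -/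
def extend {m n : ℕ} (f : ⦋m⦌ ⟶ ⦋n⦌) : ⦋m + 1⦌ ⟶ ⦋n + 1⦌ :=
  SimplexCategory.Hom.mk
    { toFun := Fin.cases 0 fun i => (f.toOrderHom i).succ
      monotone' := by
        intro a b h
        induction a using Fin.cases with
        | zero => exact Fin.zero_le _
        | succ a =>
          induction b using Fin.cases with
          | zero => exact absurd h (by simp)
          | succ b =>
            exact Fin.succ_le_succ_iff.2 (f.toOrderHom.monotone (Fin.succ_le_succ_iff.1 h)) }

theorem Step.prepend (g : x ⟶ y) {s t : MarkedString z y} (h : Step s t) :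
    Step (s.prepend g) (t.prepend g) := by
  obtain ⟨l, σ, hσ, hσ', M⟩ := s
  obtain ⟨l', τ, hτ, hτ', M'⟩ := t
  obtain ⟨(f : ⦋l⦌ ⟶ ⦋l'⦌), (h0 : f.toOrderHom 0 = 0),
    (h1 : f.toOrderHom (Fin.last l) = Fin.last l'),
    (h2 : σ = finFunctor f ⋙ τ), (h3 : ∀ c, M' c = f.toOrderHom '' M c)⟩ := h
  subst h2
  obtain rfl : M' = fun c => f.toOrderHom '' M c := funext h3
  refine ⟨extend f, rfl, congrArg Fin.succ h1, ?_, fun c => ?_⟩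
  · subst hτ
    refine Eq.trans ?_ (precomp_comp (extend f) _)
    refine congrArg (ComposableArrows.precomp (finFunctor f ⋙ τ)) ?_
    refine Eq.trans ?_ (precomp_map_zero_succ τ _ (f.toOrderHom 0)).symm
    have key : ∀ (j : Fin (l' + 1)) (hj : τ.obj 0 = τ.obj j) (_ : j = 0),
        eqToHom hj = τ.map (homOfLE (Fin.zero_le j)) := by
      rintro _ _ rfl
      exact (τ.map_id 0).symm
    exact (congrArg (fun e => g ≫ e) (key _ hσ.symm h0)).trans
      (congrArg (fun e => e ≫ τ.map (homOfLE (Fin.zero_le (f.toOrderHom 0))))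
        (Category.comp_id g).symm)
  · simp only [MarkedString.prepend, Set.image_image]
    rfl

theorem Step.mark (c : ℕ) {s t : MarkedString z x} (h : Step s t) :
    Step (s.mark c) (t.mark c) := by
  obtain ⟨f, h0, h1, h2, h3⟩ := h
  refine ⟨f, h0, h1, h2, fun d => ?_⟩
  by_cases hd : d = c
  · subst hd
    simp only [MarkedString.mark, Function.update_self, h3]
    refine Eq.trans ?_ (Set.image_insert_eq (f := f.toOrderHom)).symm
    rw [h0]
  · simp only [MarkedString.mark, Function.update_of_ne hd, h3]
    rfl

/-- The operator is the degeneracy that repeats the first object. -/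
theorem step_prepend_id (s : MarkedString z x) : Step (s.prepend (𝟙 x)) s := by
  obtain ⟨l, τ, rfl, hτ', M⟩ := s
  refine ⟨SimplexCategory.Hom.mk
    { toFun := Fin.cases 0 fun i => i
      monotone' := by
        intro a b h
        induction a using Fin.cases with
        | zero => exact Fin.zero_le _
        | succ a =>
          induction b using Fin.cases with
          | zero => exact absurd h (by simp)
          | succ b => exact Fin.succ_le_succ_iff.1 h }, rfl, rfl, ?_, fun c => ?_⟩
  · refine Eq.trans ?_ (precomp_comp _ _)
    exact congrArg (ComposableArrows.precomp τ) ((Category.comp_id _).trans (τ.map_id 0).symm)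
  · simp only [MarkedString.prepend, Set.image_image]
    exact (Set.image_id _).symm

/-- The operator is the face that skips the object between `g` and `h`. This is allowed because
prepending an arrow adds no marks. -/
theorem step_prepend_comp {x' : B} (g : x' ⟶ x) (h : x ⟶ y) (s : MarkedString z y) :
    Step (s.prepend (g ≫ h)) ((s.prepend h).prepend g) := by
  obtain ⟨l, τ, rfl, hτ', M⟩ := s
  refine ⟨SimplexCategory.Hom.mk
    { toFun := Fin.cases 0 fun i => i.succ.succ
      monotone' := by
        intro a b h
        induction a using Fin.cases with
        | zero => exact Fin.zero_le _
        | succ a =>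
          induction b using Fin.cases with
          | zero => exact absurd h (by simp)
          | succ b => exact Fin.succ_le_succ_iff.2 h }, rfl, rfl, ?_, fun c => ?_⟩
  · refine Eq.trans ?_ (precomp_comp _ _)
    refine congrArg (ComposableArrows.precomp τ) ?_
    change (g ≫ h) ≫ 𝟙 _ = (g ≫ 𝟙 _) ≫ h ≫ 𝟙 _
    simp
  · simp only [MarkedString.prepend, Set.image_image]
    rfl

end MarkedString

end

/-! ### Classes of marked strings and the action of the iterated free categories on them -/

section

variable {B : Type w} [SmallCategory B]

/-- Equivalence classes of marked strings. -/
def StringClass (z x : B) : Type w := Quot (MarkedString.Step (z := z) (x := x))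

namespace StringClass

variable {z x y : B}

/-- Add an arrow at the beginning of a string. -/
def prepend (g : x ⟶ y) : StringClass z y → StringClass z x :=
  Quot.map (MarkedString.prepend g) fun _ _ h => h.prepend g

/-- Mark the first object of a string. -/
def mark (c : ℕ) : StringClass z x → StringClass z x :=
  Quot.map (MarkedString.mark c) fun _ _ h => h.mark c

theorem mark_mark_self (c : ℕ) (s : StringClass z x) : mark c (mark c s) = mark c s := by
  induction s using Quot.ind with
  | mk s =>
    refine congrArg (fun M => Quot.mk MarkedString.Step ⟨s.len, s.str, s.first, s.last, M⟩) ?_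
    simp only [MarkedString.mark, Function.update_idem, Function.update_self]
    exact congrArg (Function.update s.marks c) (Set.insert_eq_of_mem (Set.mem_insert 0 _))

theorem mark_comm {c d : ℕ} (h : c ≠ d) (s : StringClass z x) :
    mark c (mark d s) = mark d (mark c s) := by
  induction s using Quot.ind with
  | mk s =>
    refine congrArg (Quot.mk _) ?_
    simp only [MarkedString.mark, Function.update_of_ne h, Function.update_of_ne h.symm]
    rw [Function.update_comm h]
    rfl

/-- The first object of a string carries all marks less than `m`. -/
def IsMarked (m : ℕ) (s : StringClass z x) : Prop := ∀ c < m, mark c s = s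

theorem IsMarked.of_succ {m : ℕ} {s : StringClass z x} (h : IsMarked (m + 1) s) : IsMarked m s :=
  fun c hc => h c (hc.trans m.lt_succ_self)

/-- The category structure on the objects of `B` whose morphisms from `x` to `y` are
the maps from strings starting at `y` to strings starting at `x`. -/
@[reducible]
def actionCat (z : B) (m : ℕ) : Category.{w} B where
  Hom x y := {s : StringClass z y // IsMarked m s} → {s : StringClass z x // IsMarked m s}
  id _ s := s
  comp f g s := f (g s)

/-- Add the arrow given by a function at the beginning of a string and mark its source. -/
def actGen {m : ℕ} (φ : {s : StringClass z y // IsMarked m s} →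
      {s : StringClass z x // IsMarked m s}) (s : {s : StringClass z y // IsMarked (m + 1) s}) :
    {s : StringClass z x // IsMarked (m + 1) s} :=
  ⟨mark m (φ ⟨s.1, s.2.of_succ⟩).1, fun c hc => by
    rcases (Nat.lt_succ_iff.1 hc).lt_or_eq with h | rfl
    · rw [mark_comm h.ne, (φ ⟨s.1, s.2.of_succ⟩).2 c h]
    · exact mark_mark_self _ _⟩

/-- The action of the arrows of `(FU)ᵐ B` on classes of strings. -/
def act (z : B) : (m : ℕ) →
    FunctorOver (fun x : B => x) (iter B m) (actionCat z m)
  | 0 =>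
    { map := fun p s => ⟨prepend p s.1, fun c hc => absurd hc (Nat.not_lt_zero c)⟩
      map_id := fun x => by
        funext ⟨s, hs⟩
        refine Subtype.ext ?_
        obtain ⟨s, rfl⟩ := Quot.exists_rep s
        exact Quot.sound (MarkedString.step_prepend_id s)
      map_comp := fun p q => by
        funext ⟨s, hs⟩
        refine Subtype.ext ?_
        obtain ⟨s, rfl⟩ := Quot.exists_rep s
        exact Quot.sound (MarkedString.step_prepend_comp p q s) }
  -- The new colour is `m`: colours count the levels of parentheses from the inside, so an
  -- additional outer pair leaves the older colours alone. An identity generator acts trivially only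
  -- if the first object already carries the colour `m`, whence the restriction to strings
  -- satisfying `IsMarked`.
  | m + 1 => free.lift (fun x => x) (fun q => actGen ((act z m).map q)) (fun x => by
      change actGen ((act z m).map ((iter B m).id x)) = _
      rw [(act z m).map_id]
      funext ⟨s, hs⟩
      exact Subtype.ext (hs m m.lt_succ_self))

theorem act_unit {m : ℕ} (q : (iter B m).Hom x y) :
    (act z (m + 1)).map (free.unit q) = actGen ((act z m).map q) :=
  free.lift_unit _ _ _ q

end StringClass

/-! ### Strings given by intervals in a simplex -/

section

open Simplicial

variable {k : ℕ}

/-- The inclusion of the interval `[i, k]` in `[0, k]`. -/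
def upper (i : Fin (k + 1)) : ⦋k - i⦌ ⟶ ⦋k⦌ :=
  SimplexCategory.Hom.mk
    { toFun := fun (t : Fin (k - i + 1)) => (⟨i + t, by omega⟩ : Fin (k + 1))
      monotone' := fun _ _ h => Nat.add_le_add_left h _ }

/-- The inclusion of the interval `[j, k]` in `[i, k]`, extended by the first element. -/
def upperStep {i j : Fin (k + 1)} (h : i ≤ j) : ⦋k - j + 1⦌ ⟶ ⦋k - i⦌ :=
  SimplexCategory.Hom.mk
    { toFun := Fin.cases (0 : Fin (k - i + 1)) fun (t : Fin (k - j + 1)) =>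
        (⟨j - i + t, by have : (i : ℕ) ≤ j := h; omega⟩ : Fin (k - i + 1))
      monotone' := by
        intro a b h
        induction a using Fin.cases with
        | zero => exact Fin.zero_le _
        | succ a =>
          induction b using Fin.cases with
          | zero => exact absurd h (by simp)
          | succ b => exact Nat.add_le_add_left (Fin.succ_le_succ_iff.1 h) _ }

/-- The string given by the last part of a simplex. -/
def upperString (σ : ComposableArrows B k) (i : Fin (k + 1)) (M : ℕ → Set (Fin (k + 1))) :
    MarkedString (σ.obj (Fin.last k)) (σ.obj i) where
  len := k - i
  str := finFunctor (upper i) ⋙ σ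
  first := congrArg σ.obj (Fin.ext (Nat.add_zero _))
  last := congrArg σ.obj (Fin.ext (show (i : ℕ) + (k - i) = k by omega))
  marks c := (upper i).toOrderHom ⁻¹' M c

theorem map_homOfLE_comp_eqToHom {n : ℕ} (σ : ComposableArrows B n) {a b a' b' : Fin (n + 1)}
    (h : a ≤ b) (h' : a' ≤ b') (ha : a = a') (hb : b = b') {y : B} (h1 : σ.obj b = y)
    (h2 : σ.obj a = σ.obj a') (h3 : σ.obj b' = y) :
    σ.map (homOfLE h) ≫ eqToHom h1 = eqToHom h2 ≫ σ.map (homOfLE h') ≫ eqToHom h3 := by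
  subst ha hb
  simp

/-- The operator skips the positions strictly between `i` and `j`, or repeats the first one if `i =
j`. By `hM`, no marks lie before `j`, so none are lost. -/
theorem step_prepend_upperString (σ : ComposableArrows B k) {i j : Fin (k + 1)} (h : i ≤ j)
    (M : ℕ → Set (Fin (k + 1))) (hM : ∀ c, M c ⊆ Set.Ici j) :
    MarkedString.Step ((upperString σ j M).prepend (σ.map (homOfLE h))) (upperString σ i M) := by
  have hij : (i : ℕ) ≤ j := h
  refine ⟨upperStep h, rfl, Fin.ext (show (j - i + (k - j) : ℕ) = k - i by omega), ?_,
    fun c => ?_⟩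
  · have e : finFunctor (SimplexCategory.δ 0 ≫ upperStep h ≫ upper i) = finFunctor (upper j) := by
      congr 1
      ext t : 3
      exact Fin.ext (show (i + (j - i + t) : ℕ) = j + t by omega)
    refine ComposableArrows.ext_succ (congrArg σ.obj (Fin.ext (Nat.add_zero _).symm))
      (congrArg (fun H => H ⋙ σ) e.symm) ?_
    exact map_homOfLE_comp_eqToHom σ h _ (Fin.ext (Nat.add_zero _).symm)
      (Fin.ext (show (j : ℕ) = i + (j - i + 0) by omega)) _ _ _
  · ext t
    constructor
    · intro ht
      have h1 : (j : ℕ) ≤ i + t := hM c ht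
      refine ⟨Fin.succ (⟨i + t - j, ?_⟩ : Fin (k - j + 1)), ⟨_, ?_, rfl⟩, ?_⟩
      · have := t.2
        change (t : ℕ) < k - i + 1 at this
        omega
      · change _ ∈ M c
        convert! (show (upper i).toOrderHom t ∈ M c from ht)
        exact Fin.ext (show (j + (i + t - j) : ℕ) = i + t by omega)
      · exact Fin.ext (show (j - i + (i + t - j) : ℕ) = t by omega)
    · rintro ⟨_, ⟨t, ht, rfl⟩, rfl⟩
      change _ ∈ M c
      convert! (show (upper j).toOrderHom t ∈ M c from ht)
      exact Fin.ext (show (i + (j - i + t) : ℕ) = j + t by omega)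

/-- The marks given by an arrow of `(FU)ᵐ [k]`. -/
def chainMarks {m : ℕ} {i j : Ord.{w} ⦋k⦌} (T : Chain m i j) (c : ℕ) : Set (Fin (k + 1)) :=
  {t | ∃ s : Fin m, s + c + 1 = m ∧ ⟨t⟩ ∈ T.set s}

theorem chainMarks_comp {m : ℕ} {i j l : Ord.{w} ⦋k⦌} (T : Chain m i j) (T' : Chain m j l) (c : ℕ) :
    chainMarks (T.comp T') c = chainMarks T c ∪ chainMarks T' c := by
  ext t
  constructor
  · rintro ⟨s, hs, ht | ht⟩
    · exact Or.inl ⟨s, hs, ht⟩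
    · exact Or.inr ⟨s, hs, ht⟩
  · rintro (⟨s, hs, ht⟩ | ⟨s, hs, ht⟩)
    · exact ⟨s, hs, Or.inl ht⟩
    · exact ⟨s, hs, Or.inr ht⟩

theorem chainMarks_self {m : ℕ} {i j : Ord.{w} ⦋k⦌} (T : Chain m i j) : chainMarks T m = ∅ := by
  ext t
  refine iff_of_false ?_ id
  rintro ⟨s, hs, -⟩
  omega

/-- Colour `c` belongs to the set with index `m - 1 - c`. A new smallest set therefore receives the
colour `m`, and the other colours stay in place. -/
theorem chainMarks_cons {m : ℕ} {i j : Ord.{w} ⦋k⦌} (T : Chain m i j) (c : ℕ) :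
    chainMarks T.cons c = Function.update (chainMarks T) m {i.down, j.down} c := by
  ext t
  by_cases hc : c = m
  · subst hc
    rw [Function.update_self]
    constructor
    · rintro ⟨s, hs, ht⟩
      obtain rfl : s = 0 := Fin.ext (show (s : ℕ) = 0 by omega)
      rcases ht with rfl | rfl
      · exact Or.inl rfl
      · exact Or.inr rfl
    · rintro (rfl | rfl)
      · exact ⟨0, by simp, Or.inl rfl⟩
      · exact ⟨0, by simp, Or.inr rfl⟩
  · rw [Function.update_of_ne hc]
    constructor
    · rintro ⟨s, hs, ht⟩
      induction s using Fin.cases with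
      | zero => exact absurd (by simpa using hs) hc
      | succ s => exact ⟨s, by simp at hs; omega, ht⟩
    · rintro ⟨s, hs, ht⟩
      exact ⟨s.succ, by simp; omega, ht⟩

theorem mark_upperString (σ : ComposableArrows B k) (i : Fin (k + 1))
    (M : ℕ → Set (Fin (k + 1))) (c : ℕ) :
    (upperString σ i M).mark c = upperString σ i (Function.update M c (insert i (M c))) := by
  refine congrArg (fun M => (⟨k - i, finFunctor (upper i) ⋙ σ, congrArg σ.obj
    (Fin.ext (Nat.add_zero _)), congrArg σ.obj (Fin.ext (show (i : ℕ) + (k - i) = k by omega)),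
    M⟩ : MarkedString (σ.obj (Fin.last k)) (σ.obj i))) ?_
  funext d
  ext t
  by_cases hd : d = c
  · subst hd
    rw [Function.update_self, Function.update_self]
    refine or_congr ?_ Iff.rfl
    constructor
    · rintro rfl
      exact Fin.ext (Nat.add_zero _)
    · intro h
      have := congrArg Fin.val h
      exact Fin.ext (show (t : ℕ) = 0 from by change (i + t : ℕ) = i at this; omega)
  · rw [Function.update_of_ne hd, Function.update_of_ne hd]
    rfl

open StringClass in
-- An arrow coming from `σ` lengthens the string from `[j, k]` to `[i, k]` and adds the marks of its
-- chain. The marks `M` are arbitrary because, in a composite, the first factor acts on a string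
-- already marked by the second. A generator marks only its source; its target is marked beforehand
-- by `hM'`.
theorem act_upperString (σ : ComposableArrows B k) {m : ℕ} {i j : Ord.{w} ⦋k⦌}
    (p : (iter (Ord.{w} ⦋k⦌) m).Hom i j) (M : ℕ → Set (Fin (k + 1)))
    (hM : ∀ c, M c ⊆ Set.Ici j.down) (hM' : ∀ c < m, j.down ∈ M c)
    (hs : IsMarked m (Quot.mk MarkedString.Step (upperString σ j.down M))) :
    ((act (σ.obj (Fin.last k)) m).map ((iterMap (ordSimplex (n := ⦋k⦌) σ) m).map p)
      ⟨Quot.mk MarkedString.Step (upperString σ j.down M), hs⟩).1 =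
      Quot.mk MarkedString.Step (upperString σ i.down fun c => M c ∪ chainMarks (chainOf p) c) := by
  induction m generalizing i j M with
  | zero =>
    have e : (fun c => M c ∪ chainMarks (chainOf p) c) = M := by
      funext c
      refine Set.union_eq_left.2 ?_
      rintro t ⟨s, _⟩
      exact s.elim0
    rw [e]
    have h : i ≤ j := le_of_hom p
    exact Quot.sound (step_prepend_upperString σ (show i.down ≤ j.down from h) M hM)
  | succ m ih =>
    induction p using free.hom_induction' generalizing M with
    | id x =>
      have e := (congrArg (act (σ.obj (Fin.last k)) (m + 1)).map
        ((iterMap (ordSimplex (n := ⦋k⦌) σ) (m + 1)).map_id x)).trans (FunctorOver.map_id _ _)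
      refine (congrArg (fun φ => (φ ⟨_, hs⟩).1) e).trans ?_
      have e : (fun c => M c ∪ chainMarks (chainOf ((iter _ (m + 1)).id x)) c) = M := by
        funext c
        refine Set.union_eq_left.2 ?_
        rintro t ⟨s, hs, ht⟩
        rw [chainOf_id] at ht
        obtain rfl : t = x.down := congrArg ULift.down ht
        exact hM' c (by omega)
      refine congrArg (fun M => Quot.mk MarkedString.Step (upperString σ x.down M)) e.symm
    | unit q =>
      have e := (congrArg (act (σ.obj (Fin.last k)) (m + 1)).map
        (free.map_unit (iterMap (ordSimplex (n := ⦋k⦌) σ) m) q)).trans (act_unit _)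
      refine (congrArg (fun φ => (φ ⟨_, hs⟩).1) e).trans ?_
      refine (congrArg (mark m) (ih q M hM (fun c hc => hM' c (hc.trans m.lt_succ_self))
        hs.of_succ)).trans ?_
      refine congrArg (Quot.mk MarkedString.Step) ((mark_upperString _ _ _ _).trans ?_)
      refine congrArg (upperString σ _) (funext fun c => ?_)
      refine Eq.trans ?_ (congrArg (fun T => M c ∪ chainMarks T c) (chainOf_unit q).symm)
      rw [chainMarks_cons]
      by_cases hc : c = m
      · subst hc
        rw [Function.update_self, Function.update_self, chainMarks_self, Set.union_empty]
        ext t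
        have := hM' c c.lt_succ_self
        simp only [Set.mem_insert_iff, Set.mem_union, Set.mem_singleton_iff]
        constructor
        · rintro (h | h)
          · exact Or.inr (Or.inl h)
          · exact Or.inl h
        · rintro (h | h | rfl)
          · exact Or.inr h
          · exact Or.inl h
          · exact Or.inr this
      · rw [Function.update_of_ne hc, Function.update_of_ne hc]
    | @comp x y z p q hp hq =>
      have e := (congrArg (act (σ.obj (Fin.last k)) (m + 1)).map
        ((iterMap (ordSimplex (n := ⦋k⦌) σ) (m + 1)).map_comp p q)).trans
          (FunctorOver.map_comp _ _ _)
      refine (congrArg (fun φ => (φ ⟨_, hs⟩).1) e).trans ?_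
      have h1 := hq M hM hM' hs
      have hs' : IsMarked (m + 1) (Quot.mk MarkedString.Step (upperString σ y.down
          fun c => M c ∪ chainMarks (chainOf (m := m + 1) q) c)) := by
        rw [← h1]
        exact Subtype.property _
      refine (congrArg (fun s => ((act (σ.obj (Fin.last k)) (m + 1)).map
        ((iterMap (ordSimplex (n := ⦋k⦌) σ) (m + 1)).map p) s).1)
        (Subtype.ext (a2 := ⟨_, hs'⟩) h1)).trans ?_
      refine (hp _ ?_ ?_ hs').trans ?_
      · have hyz : y ≤ z := le_of_hom (m := m + 1) q
        refine fun c => Set.union_subset ((hM c).trans (Set.Ici_subset_Ici.2 hyz)) ?_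
        rintro t ⟨s, _, ht⟩
        exact (Chain.bdd _ s ht).1
      -- Among `m + 1` sets, the colour `c` belongs to the one with index `m - c`, which contains
      -- its left endpoint `y`.
      · exact fun c hc => Or.inr ⟨⟨m - c, by omega⟩, by simp only; omega, Chain.left _ _⟩
      · refine congrArg (fun M => Quot.mk MarkedString.Step (upperString σ x.down M)) ?_
        funext c
        rw [Set.union_assoc, Set.union_comm (chainMarks (chainOf (m := m + 1) q) c),
          ← chainMarks_comp]
        exact congrArg (fun T => M c ∪ chainMarks T c) (chainOf_comp (m := m + 1) p q).symm

end

end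

/-! ### Extension of a family of diagrams to the free resolution of a category -/

section

open Simplicial

variable {B : Type w} [SmallCategory B]

/-- The chain which is generated by the marks of a string. -/
def markChain {l : ℕ} (M : ℕ → Set (Fin (l + 1))) (m : ℕ) :
    Chain (m + 1) (⟨0⟩ : Ord.{w} ⦋l⦌) ⟨Fin.last l⟩ where
  -- Arbitrary marks need be neither nested nor contain the ends. Hence the ends are added, and the
  -- set with index `s` collects all colours from `m - s` to `m`.
  set s := {t | t.down = 0 ∨ t.down = Fin.last l ∨ ∃ c, m ≤ c + s ∧ c ≤ m ∧ t.down ∈ M c}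
  mono a b h t ht := by
    have h' : (a : ℕ) ≤ b := h
    rcases ht with ht | ht | ⟨c, h1, h2, h3⟩
    · exact Or.inl ht
    · exact Or.inr (Or.inl ht)
    · exact Or.inr (Or.inr ⟨c, by omega, h2, h3⟩)
  le := Fin.zero_le (Fin.last l)
  left _ := Or.inl rfl
  right _ := Or.inr (Or.inl rfl)
  bdd _ t _ := ⟨Fin.zero_le t.down, Fin.le_last t.down⟩

theorem markChain_map {l l' : ℕ} (f : ⦋l⦌ ⟶ ⦋l'⦌) (h0 : f.toOrderHom 0 = 0)
    (h1 : f.toOrderHom (Fin.last l) = Fin.last l') (M : ℕ → Set (Fin (l + 1))) (m : ℕ) :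
    ((markChain.{w} M m).map (DiagramFamily.ordMap f) (DiagramFamily.ordMap_monotone f)).set =
      (markChain (fun c => f.toOrderHom '' M c) m).set := by
  ext s t
  constructor
  · rintro ⟨t, ht | ht | ⟨c, h1, h2, h3⟩, rfl⟩
    · exact Or.inl ((congrArg f.toOrderHom ht).trans h0)
    · exact Or.inr (Or.inl ((congrArg f.toOrderHom ht).trans h1))
    · exact Or.inr (Or.inr ⟨c, h1, h2, _, h3, rfl⟩)
  · rintro (ht | ht | ⟨c, h1, h2, t', h3, h4⟩)
    · exact ⟨⟨0⟩, Or.inl rfl, ULift.ext _ _ (h0.trans ht.symm)⟩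
    · exact ⟨⟨Fin.last l⟩, Or.inr (Or.inl rfl), ULift.ext _ _ (h1.trans ht.symm)⟩
    · exact ⟨⟨t'⟩, Or.inr (Or.inr ⟨c, h1, h2, h3⟩), ULift.ext _ _ h4⟩

namespace DiagramFamily

variable {S : Type u} [EnrichedCategory SSet.{w} S] (Φ : DiagramFamily.{w} B S)
  (hΦ : ∀ (n : SimplexCategory) (σ : Fin (n.len + 1) ⥤ B), Φ.mem n σ)

/-- The value of a family of diagrams on a marked string. -/
noncomputable def value (m : SimplexCategory) {z x : B} (s : MarkedString z x) :
    SHom m (Φ.obj x) (Φ.obj z) :=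
  SHom.cast (congrArg Φ.obj s.first) (congrArg Φ.obj s.last)
    (Φ.cval (hΦ ⦋s.len⦌ s.str) m (markChain s.marks m.len))

/-- The family is compatible with the operator `f`, and `f` carries the chain of the first string to
that of the second. -/
theorem value_step (m : SimplexCategory) {z x : B} {s t : MarkedString z x}
    (h : MarkedString.Step s t) : Φ.value hΦ m s = Φ.value hΦ m t := by
  obtain ⟨l, σ, hσ, hσ', M⟩ := s
  obtain ⟨l', τ, hτ, hτ', M'⟩ := t
  obtain ⟨(f : ⦋l⦌ ⟶ ⦋l'⦌), (h0 : f.toOrderHom 0 = 0),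
    (h1 : f.toOrderHom (Fin.last l) = Fin.last l'),
    (h2 : σ = finFunctor f ⋙ τ), (h3 : ∀ c, M' c = f.toOrderHom '' M c)⟩ := h
  subst h2
  obtain rfl : M' = fun c => f.toOrderHom '' M c := funext h3
  have e := Φ.cval_congr (hΦ ⦋l'⦌ τ) rfl m _ _ (ULift.ext ⟨f.toOrderHom 0⟩ ⟨0⟩ h0)
    (ULift.ext ⟨f.toOrderHom (Fin.last l)⟩ ⟨Fin.last l'⟩ h1) (markChain_map f h0 h1 M m.len)
  unfold value
  refine Eq.trans ?_ (congrArg (SHom.cast _ _) e)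
  rw [SHom.cast_cast]
  exact congrArg (SHom.cast _ _) (Φ.cval_map (hΦ ⦋l'⦌ τ) f m (markChain M m.len))

/-- The value of a family of diagrams on an equivalence class of marked strings. -/
noncomputable def classValue (m : SimplexCategory) {z x : B} :
    StringClass z x → SHom m (Φ.obj x) (Φ.obj z) :=
  Quot.lift (Φ.value hΦ m) fun _ _ h => Φ.value_step hΦ m h

end DiagramFamily

/-- The string of length zero. -/
def startString (y : B) : MarkedString y y :=
  ⟨0, ComposableArrows.mk₀ y, rfl, rfl, fun _ => Set.univ⟩

/-- The only object carries every colour, so arrows of all levels can act on this string. -/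
theorem startString_mark (y : B) (m : ℕ) :
    StringClass.IsMarked m (Quot.mk MarkedString.Step (startString y)) := fun c _ => by
  refine congrArg (fun M => Quot.mk MarkedString.Step
    (⟨0, ComposableArrows.mk₀ y, rfl, rfl, M⟩ : MarkedString y y)) ?_
  funext d
  by_cases hd : d = c
  · subst hd
    rw [Function.update_self]
    exact Set.insert_eq_of_mem (Set.mem_univ 0)
  · rw [Function.update_of_ne hd]
    rfl

theorem step_startString {k : ℕ} (σ : ComposableArrows B k) :
    MarkedString.Step (startString (σ.obj (Fin.last k)))
      (upperString σ (Fin.last k) fun _ => {Fin.last k}) := by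
  refine ⟨SimplexCategory.const _ _ 0, rfl, Fin.ext (show 0 = k - k by omega), ?_, fun c => ?_⟩
  · exact ComposableArrows.ext₀ (congrArg σ.obj (Fin.ext (Nat.add_zero _).symm))
  · ext t
    have ht : (t : ℕ) < k - k + 1 := t.2
    constructor
    · intro _
      exact ⟨0, trivial, Fin.ext (show 0 = (t : ℕ) by omega)⟩
    · rintro ⟨_, _, rfl⟩
      exact Fin.ext (Nat.add_zero _)

namespace DiagramFamily

variable {S : Type u} [EnrichedCategory SSet.{w} S] (Φ : DiagramFamily.{w} B S)
  (hΦ : ∀ (n : SimplexCategory) (σ : Fin (n.len + 1) ⥤ B), Φ.mem n σ)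

/-- The extension of a family of diagrams to the arrows of the free resolution. -/
noncomputable def extHom (m : SimplexCategory) {x y : B} (p : (iter B (m.len + 1)).Hom x y) :
    SHom m (Φ.obj x) (Φ.obj y) :=
  Φ.classValue hΦ m ((StringClass.act y (m.len + 1)).map p ⟨_, startString_mark y _⟩).1

/-- The start string represents the part `[k, k]` of `σ`, so `act_upperString` yields the part `[i,
k]` marked by `chainOf p`. The chain generated by these marks is `chainOf p` again, its sets being
nested and containing the ends. The target is the last vertex because strings cut out of `σ` end
there. -/
theorem extHom_iterMap_last {k : ℕ} (σ : ComposableArrows B k) (m : SimplexCategory)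
    {i : Ord.{w} ⦋k⦌} (p : (iter (Ord.{w} ⦋k⦌) (m.len + 1)).Hom i ⟨Fin.last k⟩) :
    Φ.extHom hΦ m ((iterMap (ordSimplex (n := ⦋k⦌) σ) _).map p) = Φ.val (hΦ ⦋k⦌ σ) m p := by
  have hs := startString_mark (σ.obj (Fin.last k)) (m.len + 1)
  have e : Quot.mk MarkedString.Step (startString (σ.obj (Fin.last k))) =
    Quot.mk MarkedString.Step (upperString σ (Fin.last k) fun _ => {Fin.last k}) :=
    Quot.sound (step_startString σ)
  have hs' := hs
  rw [e] at hs'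
  refine (congrArg (fun s => Φ.classValue hΦ m (((StringClass.act (σ.obj (Fin.last k))
    (m.len + 1)).map ((iterMap (ordSimplex (n := ⦋k⦌) σ) _).map p)) s).1)
    (Subtype.ext (a1 := ⟨_, hs⟩) (a2 := ⟨_, hs'⟩) e)).trans ?_
  refine (congrArg (Φ.classValue hΦ m) (act_upperString σ p (fun _ => {Fin.last k}) ?_ ?_
    hs')).trans ?_
  · rintro c t ht
    exact (Set.mem_singleton_iff.1 ht).ge
  · exact fun _ _ => rfl
  rw [← cval_chainOf]
  set M : ℕ → Set (Fin (k + 1)) := fun c => {Fin.last k} ∪ chainMarks (chainOf p) c with hM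
  have hik : (i.down : ℕ) < k + 1 := i.down.2
  have h1 : (⟨(upper i.down).toOrderHom 0⟩ : Ord.{w} ⦋k⦌) = i :=
    ULift.ext _ _ (Fin.ext (Nat.add_zero _))
  have h2 : (⟨(upper i.down).toOrderHom (Fin.last (k - i.down))⟩ : Ord.{w} ⦋k⦌) = ⟨Fin.last k⟩ :=
    ULift.ext _ _ (Fin.ext (show (i.down + (k - i.down) : ℕ) = k by omega))
  have h3 : ((markChain.{w} (upperString σ i.down M).marks m.len).map (ordMap (upper i.down))
      (ordMap_monotone (upper i.down))).set = (chainOf p).set := by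
    have aux : ∀ {s : Set (Ord.{w} ⦋k⦌)} {a b : Ord.{w} ⦋k⦌}, a = b → b ∈ s → a ∈ s :=
      fun e h => e ▸ h
    ext s t
    constructor
    · rintro ⟨t, ht | ht | ⟨c, hc, hc', ht | ⟨s', hs', ht⟩⟩, rfl⟩
      · exact aux ((congrArg (fun t => ULift.up ((upper i.down).toOrderHom t)) ht).trans h1)
          ((chainOf p).left s)
      · exact aux ((congrArg (fun t => ULift.up ((upper i.down).toOrderHom t)) ht).trans h2)
          ((chainOf p).right s)
      · exact aux (ULift.ext _ _ ht) ((chainOf p).right s)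
      · exact (chainOf p).mono (show s' ≤ s from (show (s' : ℕ) ≤ s by omega)) ht
    · intro ht
      have hi : (i.down : ℕ) ≤ t.down := ((chainOf p).bdd s ht).1
      have h4 : (t.down : ℕ) < k + 1 := t.down.2
      have h5 : (upper i.down).toOrderHom (⟨t.down - i.down, by omega⟩ : Fin (k - i.down + 1)) =
        t.down := Fin.ext (show (i.down + (t.down - i.down) : ℕ) = t.down by omega)
      exact ⟨⟨⟨t.down - i.down, by change _ < k - i.down + 1; omega⟩⟩,
        Or.inr (Or.inr ⟨m.len - s, by omega, by omega, Or.inr ⟨s, by omega,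
          aux (ULift.ext _ _ h5) ht⟩⟩), ULift.ext _ _ h5⟩
  have e' := Φ.cval_congr (hΦ ⦋k⦌ σ) rfl m _ _ h1 h2 h3
  refine Eq.trans ?_ e'
  change Φ.value hΦ m _ = _
  unfold value
  refine Eq.trans ?_ (congrArg (SHom.cast _ _) (Φ.cval_map (hΦ ⦋k⦌ σ) (upper i.down) m
    (markChain (upperString σ i.down M).marks m.len)))
  rfl

end DiagramFamily

end

/-! ### Uniqueness and existence of extensions from the simplices of the nerve -/

section

open Simplicial

variable {B : Type w} [SmallCategory B]

namespace CoherentDiagram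

variable {S : Type u} [EnrichedCategory SSet.{w} S]

theorem onHom_arr_congr {F G : CoherentDiagram B S} (hobj : ∀ x, F.onObj x = G.onObj x)
    (m : SimplexCategory) {x y x' y' : B} {p : (iter B (m.len + 1)).Hom x y}
    {p' : (iter B (m.len + 1)).Hom x' y'} (h : arr p = arr (𝒞 := iter B (m.len + 1)) p')
    (hp : SHom.cast (hobj x) (hobj y) (F.onHom m p) = G.onHom m p) :
    SHom.cast (hobj x') (hobj y') (F.onHom m p') = G.onHom m p' := by
  cases h; exact hp

/-- Homotopy coherent diagrams are determined by their restrictions to the simplices of the nerve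
of their shape. -/
theorem ext_of_restrict {F G : CoherentDiagram B S}
    (h : ∀ (n : SimplexCategory) (σ : Fin (n.len + 1) ⥤ B),
      F.restrict (ordSimplex.{w} σ) = G.restrict (ordSimplex σ)) : F = G := by
  have hobj : ∀ x, F.onObj x = G.onObj x := fun x =>
    onObj_congr (h ⦋0⦌ ((Functor.const _).obj x)) ⟨0⟩
  refine ext_of_onHom hobj fun m x y p => ?_
  obtain ⟨l, ρ, g, p', -, hp⟩ := exists_lift p (ComposableArrows.mk₀ y) rfl
  exact onHom_arr_congr hobj m hp (onHom_congr (h ⦋l⦌ ρ) m p')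

end CoherentDiagram

namespace DiagramFamily

variable {S : Type u} [EnrichedCategory SSet.{w} S] (Φ : DiagramFamily.{w} B S)
  (hΦ : ∀ (n : SimplexCategory) (σ : Fin (n.len + 1) ⥤ B), Φ.mem n σ)

/-- The inclusion of the initial segment `[0, j]` in `[n]`. -/
def lower {n : SimplexCategory} (j : Fin (n.len + 1)) : ⦋j⦌ ⟶ n :=
  SimplexCategory.Hom.mk
    { toFun := fun (t : Fin (j + 1)) => (⟨t, by have := j.2; have := t.2; omega⟩ : Fin (n.len + 1))
      monotone' := fun _ _ h => h }

/-- All sets of the chain of `p` lie below `j`. In the initial segment `[0, j]` the target is the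
last vertex, as `extHom_iterMap_last` requires. -/
theorem exists_iterMap_lower {n : SimplexCategory} {m : ℕ} {i j : Ord.{w} n}
    (p : (iter (Ord.{w} n) m).Hom i j) :
    ∃ (i' : Ord.{w} ⦋j.down⦌) (p' : (iter (Ord.{w} ⦋j.down⦌) m).Hom i' ⟨Fin.last j.down⟩),
      arr ((iterMap (ordFunctor (lower j.down)) m).map p') = arr p := by
  have hij : (i.down : ℕ) ≤ j.down := (le_of_hom p : i ≤ j)
  let T : Chain m (⟨⟨i.down, Nat.lt_succ_of_le hij⟩⟩ : Ord.{w} ⦋j.down⦌) ⟨Fin.last j.down⟩ :=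
    { set s := ordMap (lower j.down) ⁻¹' (chainOf p).set s
      mono := fun _ _ h => Set.preimage_mono ((chainOf p).mono h)
      le := Fin.le_last _
      left s := (chainOf p).left s
      right s := (chainOf p).right s
      bdd s t ht := ⟨((chainOf p).bdd s ht).1, ((chainOf p).bdd s ht).2⟩ }
  refine ⟨_, ofChain T, congrArg (fun f => (arr (𝒞 := iter (Ord.{w} n) m) (x := i) (y := j) f)) ?_⟩
  refine chainOf_injective ((chainOf_iterMap (ordMap_monotone (lower j.down)) _).trans ?_)
  rw [chainOf_ofChain]
  ext s t
  constructor
  · rintro ⟨t, ht, rfl⟩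
    exact ht
  · exact fun ht => ⟨⟨⟨t.down, Nat.lt_succ_of_le ((chainOf p).bdd s ht).2⟩⟩, ht, rfl⟩

theorem extHom_iterMap {n : SimplexCategory} (σ : Fin (n.len + 1) ⥤ B) (m : SimplexCategory)
    {i j : Ord.{w} n} (p : (iter (Ord.{w} n) (m.len + 1)).Hom i j) :
    Φ.extHom hΦ m ((iterMap (ordSimplex σ) _).map p) = Φ.val (hΦ n σ) m p := by
  obtain ⟨i', p', h⟩ := exists_iterMap_lower p
  have key : ∀ {i j i' j' : Ord.{w} n} {p : (iter (Ord.{w} n) (m.len + 1)).Hom i j}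
      {p' : (iter (Ord.{w} n) (m.len + 1)).Hom i' j'},
      arr p = arr (𝒞 := iter (Ord.{w} n) (m.len + 1)) p' →
      Φ.extHom hΦ m ((iterMap (ordSimplex σ) _).map p) = Φ.val (hΦ n σ) m p →
      Φ.extHom hΦ m ((iterMap (ordSimplex σ) _).map p') = Φ.val (hΦ n σ) m p' := by
    intro i j i' j' p p' h h'
    cases h; exact h'
  refine key h ?_
  refine Eq.trans ?_ (Φ.val_map (hΦ n σ) (lower j.down) m p')
  refine (congrArg (Φ.extHom hΦ m)
    (iterMap_comp (ordFunctor (lower j.down)) (ordSimplex σ) p').symm).trans ?_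
  exact Φ.extHom_iterMap_last hΦ (finFunctor (lower j.down) ⋙ σ) m p'

theorem extHom_id (m : SimplexCategory) (x : B) :
    Φ.extHom hΦ m ((iter B (m.len + 1)).id x) = SHom.id m (Φ.obj x) := by
  have h := Φ.extHom_iterMap hΦ (n := ⦋0⦌) ((Functor.const _).obj x) m
    ((iter (Ord.{w} ⦋0⦌) (m.len + 1)).id ⟨0⟩)
  rw [val_id] at h
  exact (congrArg (Φ.extHom hΦ m) (FunctorOver.map_id (iterMap (ordSimplex (n := ⦋0⦌)
    ((Functor.const _).obj x)) (m.len + 1)) ⟨0⟩).symm).trans h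

/-- Lifting `q` first and then `p` over the simplex of `q` places both in one simplex, where the
values come from a single simplicial functor. -/
theorem extHom_comp (m : SimplexCategory) {x y z : B} (p : (iter B (m.len + 1)).Hom x y)
    (q : (iter B (m.len + 1)).Hom y z) :
    Φ.extHom hΦ m ((iter B (m.len + 1)).comp p q) =
      (Φ.extHom hΦ m p).comp (Φ.extHom hΦ m q) := by
  obtain ⟨l, τ, g, q', hg, hq⟩ := exists_lift q (ComposableArrows.mk₀ z) rfl
  obtain ⟨k, ρ, f, p', hf, hp⟩ := exists_lift p τ (congrArg Sigma.fst hq)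
  have hq' : arr ((iterMap (ordSimplex (n := ⦋k⦌) ρ) _).map ((iterMap (ordFunctor f) _).map q')) =
      arr q := by
    refine Eq.trans ?_ hq
    refine (congrArg (fun e => (arr (𝒞 := iter B (m.len + 1)) e)) (iterMap_comp (ordFunctor f)
      (ordSimplex (n := ⦋k⦌) ρ) q').symm).trans ?_
    refine arr_iterMap_congr ?_ q'
    rw [← hf]; rfl
  have key : ∀ {x y z x' y' z' : B} {p : (iter B (m.len + 1)).Hom x y}
      {q : (iter B (m.len + 1)).Hom y z} {p' : (iter B (m.len + 1)).Hom x' y'}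
      {q' : (iter B (m.len + 1)).Hom y' z'},
      arr p = arr (𝒞 := iter B (m.len + 1)) p' → arr q = arr (𝒞 := iter B (m.len + 1)) q' →
      Φ.extHom hΦ m ((iter B (m.len + 1)).comp p q) =
        (Φ.extHom hΦ m p).comp (Φ.extHom hΦ m q) →
      Φ.extHom hΦ m ((iter B (m.len + 1)).comp p' q') =
        (Φ.extHom hΦ m p').comp (Φ.extHom hΦ m q') := by
    intro x y z x' y' z' p q p' q' h h' h''
    cases h; cases h'; exact h''
  refine key hp hq' ?_
  refine (congrArg (Φ.extHom hΦ m) (FunctorOver.map_comp _ _ _).symm).trans ?_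
  refine (Φ.extHom_iterMap hΦ (n := ⦋k⦌) ρ m _).trans ?_
  refine (Φ.val_comp (hΦ ⦋k⦌ ρ) m p' _).trans ?_
  exact (congrArg₂ SHom.comp (Φ.extHom_iterMap hΦ (n := ⦋k⦌) ρ m p')
    (Φ.extHom_iterMap hΦ (n := ⦋k⦌) ρ m _)).symm

theorem extHom_op {l m : SimplexCategory} (α : l ⟶ m) {x y : B}
    (p : (iter B (m.len + 1)).Hom x y) :
    Φ.extHom hΦ l ((op B _ _ α.toOrderHom).map p) = SHom.op α (Φ.extHom hΦ m p) := by
  obtain ⟨k, ρ, f, p', hf, hp⟩ := exists_lift p (ComposableArrows.mk₀ y) rfl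
  have key : ∀ {x y x' y' : B} {p : (iter B (m.len + 1)).Hom x y}
      {p' : (iter B (m.len + 1)).Hom x' y'},
      arr p = arr (𝒞 := iter B (m.len + 1)) p' →
      Φ.extHom hΦ l ((op B _ _ α.toOrderHom).map p) = SHom.op α (Φ.extHom hΦ m p) →
      Φ.extHom hΦ l ((op B _ _ α.toOrderHom).map p') = SHom.op α (Φ.extHom hΦ m p') := by
    intro x y x' y' p p' h h'
    cases h; exact h'
  refine key hp ?_
  refine (congrArg (Φ.extHom hΦ l) (op_iterMap _ _ _)).trans ?_
  refine (Φ.extHom_iterMap hΦ (n := ⦋k⦌) ρ l _).trans ?_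
  exact (Φ.val_op (hΦ ⦋k⦌ ρ) α p').trans
    (congrArg (SHom.op α) (Φ.extHom_iterMap hΦ (n := ⦋k⦌) ρ m p')).symm

/-- The extension of a family of coherent diagrams which is indexed by all simplices of the nerve
of `B` to a coherent diagram of shape `B`. -/
noncomputable def extend : CoherentDiagram B S :=
  CoherentDiagram.ofData Φ.obj (fun m _ _ p => Φ.extHom hΦ m p) (Φ.extHom_id hΦ)
    (fun m _ _ _ p q => Φ.extHom_comp hΦ m p q) (fun α _ _ p => Φ.extHom_op hΦ α p)

theorem extend_restrict {n : SimplexCategory} (σ : Fin (n.len + 1) ⥤ B) :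
    (Φ.extend hΦ).restrict (ordSimplex.{w} σ) = Φ.diag (hΦ n σ) := by
  refine CoherentDiagram.ext_of_onHom (fun i => (Φ.onObj_diag (hΦ n σ) i).symm)
    fun m i j p => ?_
  refine (congrArg (SHom.cast _ _) (Φ.extHom_iterMap hΦ σ m p)).trans ?_
  exact SHom.cast_cast _ _ _ _ _

end DiagramFamily

end

/-! ### The canonical map is an isomorphism -/

section

open Simplicial

variable {A : Type w} [SmallCategory A] {S : Type u} [EnrichedCategory SSet.{w} S]

theorem CoherentDiagram.restrict_comp {A B C : Type w} [SmallCategory A] [SmallCategory B]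
    [SmallCategory C] (H : A ⥤ B) (K : B ⥤ C) (F : CoherentDiagram C S) :
    F.restrict (H ⋙ K) = (F.restrict K).restrict H := by
  unfold CoherentDiagram.restrict
  rw [Resolution.functor_comp]
  rfl

theorem toInternalHom_app_app {n c : SimplexCategoryᵒᵖ} (F : (Coh A S).obj n) (f : n ⟶ c)
    (σ : ComposableArrows A c.unop.len) :
    (((toInternalHom A S).app n F : (Functor.functorHom (liftedNerve.{w, u} A)
      (hcNerve.{w, u} S)).obj n).app c f) ⟨σ⟩ =
      CoherentDiagram.restrict (graph (n := c.unop) σ)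
        (CoherentDiagram.restrict ((𝟭 A).prod (ordFunctor f.unop)) F) := rfl

/-- The first component of a simplex of a product. -/
abbrev simplexFst {k n : SimplexCategory} (τ : Fin (k.len + 1) ⥤ A × Ord.{w} n) :
    ComposableArrows A k.len :=
  τ ⋙ CategoryTheory.Prod.fst _ _

/-- The second component of a simplex of a product. -/
abbrev simplexSnd {k n : SimplexCategory} (τ : Fin (k.len + 1) ⥤ A × Ord.{w} n) : k ⟶ n :=
  SimplexCategory.Hom.mk ⟨fun i => (τ.obj i).2.down,
    fun _ _ h => (leOfHom (τ.map (homOfLE h)).2 : _ ≤ _)⟩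

/-- The simplex of a product with given components. -/
abbrev simplexPair {k n : SimplexCategory} (σ : ComposableArrows A k.len) (α : k ⟶ n) :
    Fin (k.len + 1) ⥤ A × Ord.{w} n :=
  σ.prod' (Monotone.functor (f := fun i => ULift.up (α.toOrderHom i))
    fun _ _ h => α.toOrderHom.monotone h)

theorem simplexPair_fst_snd {k n : SimplexCategory} (τ : Fin (k.len + 1) ⥤ A × Ord.{w} n) :
    simplexPair (simplexFst τ) (simplexSnd τ) = τ := rfl

/-- By this factorization, restricting to the simplices of `A × [n]` is the same as evaluating the
canonical map. -/
theorem ordSimplex_simplexPair {k n : SimplexCategory} (σ : ComposableArrows A k.len)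
    (α : k ⟶ n) :
    ordSimplex.{w} (simplexPair σ α) = graph σ ⋙ (𝟭 A).prod (ordFunctor α) := rfl

theorem toInternalHom_app_injective (n : SimplexCategoryᵒᵖ) :
    Function.Injective ((toInternalHom A S).app n) := by
  intro (F : CoherentDiagram (A × Ord.{w} n.unop) S) (G : CoherentDiagram (A × Ord.{w} n.unop) S) h
  refine CoherentDiagram.ext_of_restrict (B := A × Ord.{w} n.unop) (S := S) fun k τ => ?_
  rw [← simplexPair_fst_snd τ, ordSimplex_simplexPair, CoherentDiagram.restrict_comp,
    CoherentDiagram.restrict_comp]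
  exact congrArg (fun φ : (Functor.functorHom (liftedNerve.{w, u} A) (hcNerve.{w, u} S)).obj n =>
    φ.app (Opposite.op k) (simplexSnd τ).op ⟨simplexFst τ⟩) h

/-- The family of diagrams given by a simplex of the internal hom. -/
def internalHomFamily {n : SimplexCategory} (φ : (Functor.functorHom (liftedNerve.{w, u} A)
    (hcNerve.{w, u} S)).obj (Opposite.op n)) : DiagramFamily.{w} (A × Ord.{w} n) S where
  mem _ _ := True
  mem_comp _ _ _ := trivial
  mem_const _ := trivial
  diag {k} τ _ := φ.app (Opposite.op k) (simplexSnd τ).op ⟨simplexFst τ⟩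
  diag_comp {m k} α τ _ := by
    have := ConcreteCategory.congr_hom (φ.naturality α.op (simplexSnd τ).op) ⟨simplexFst τ⟩
    exact this

theorem toInternalHom_app_surjective (n : SimplexCategoryᵒᵖ) :
    Function.Surjective ((toInternalHom A S).app n) := by
  intro φ
  let Φ := internalHomFamily (n := n.unop) φ
  refine ⟨Φ.extend fun _ _ => trivial, ?_⟩
  refine Functor.functorHom_ext fun c f => ?_
  ext ⟨σ⟩
  refine (toInternalHom_app_app _ f σ).trans ?_
  rw [← CoherentDiagram.restrict_comp]
  refine (Φ.extend_restrict (fun _ _ => trivial) (simplexPair σ f.unop)).trans ?_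
  have h : (simplexSnd (simplexPair σ f.unop)).op = f :=
    Quiver.Hom.unop_inj (SimplexCategory.Hom.ext _ _ (OrderHom.ext _ _ rfl))
  exact congrArg (fun g => φ.app c g ⟨σ⟩) h

instance : IsIso (toInternalHom A S) := by
  refine (NatTrans.isIso_iff_isIso_app _).2 fun n => (isIso_iff_bijective _).2 ?_
  exact ⟨toInternalHom_app_injective n, toInternalHom_app_surjective n⟩

theorem quasicategory_coh [SSet.Quasicategory (hcNerve.{w, u} S)] :
    SSet.Quasicategory (Coh A S) := by
  have : SSet.InnerFibration (toInternalHom A S) :=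
    ⟨MorphismProperty.of_isIso SSet.innerFibrations _⟩
  exact SSet.quasicategory_of_innerFibration (toInternalHom A S)

end

/-! ### Families of diagrams on horns -/

section

/-- A nonempty subset of a finite ordinal is a retract. -/
theorem exists_retraction {n : SimplexCategory} (E : Set (Fin (n.len + 1))) (i : Fin (n.len + 1))
    (hi : i ∈ E) (hE : ∀ t ∈ E, i ≤ t) :
    ∃ ρ : n ⟶ n, (∀ x, ρ.toOrderHom x ∈ E) ∧ ∀ t ∈ E, ρ.toOrderHom t = t := by
  classical
  -- The retraction sends `x` to the largest element of `E` not above `x`, or to the least element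
  -- `i` of `E` if `x` lies below `i`.
  let F (x : Fin (n.len + 1)) : Finset (Fin (n.len + 1)) :=
    Finset.univ.filter fun t => t ∈ E ∧ t ≤ max i x
  have hF (x) : (F x).Nonempty := ⟨i, by simp [F, hi]⟩
  have hF' (x) : (F x).max' (hF x) ∈ E ∧ (F x).max' (hF x) ≤ max i x := by
    have := (F x).max'_mem (hF x)
    exact (Finset.mem_filter.1 this).2
  refine ⟨SimplexCategory.Hom.mk ⟨fun x => (F x).max' (hF x), fun x y h => ?_⟩,
    fun x => (hF' x).1, fun t ht => ?_⟩
  · refine Finset.max'_subset _ fun t ht => ?_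
    simp only [F, Finset.mem_filter, Finset.mem_univ, true_and] at ht ⊢
    exact ⟨ht.1, ht.2.trans (max_le_max le_rfl h)⟩
  · refine le_antisymm ((hF' t).2.trans (max_le (hE t ht) le_rfl)) (Finset.le_max' _ _ ?_)
    simp [F, ht]

namespace Chain

variable {n : SimplexCategory} {m : ℕ} {i j : Ord.{w} n}

theorem exists_retraction (T : Chain (m + 1) i j) :
    ∃ ρ : n ⟶ n, (∀ x, ULift.up (ρ.toOrderHom x) ∈ T.set (Fin.last m)) ∧
      ∀ t ∈ T.set (Fin.last m), ρ.toOrderHom t.down = t.down := by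
  obtain ⟨ρ, h1, h2⟩ := HoCoh.exists_retraction (ULift.up ⁻¹' T.set (Fin.last m)) i.down
    (T.left _) fun t ht => (T.bdd _ ht).1
  exact ⟨ρ, h1, fun t ht => h2 t.down ht⟩

/-- A retraction to the largest member of a chain. -/
noncomputable def retraction (T : Chain (m + 1) i j) : n ⟶ n := T.exists_retraction.choose

theorem retraction_mem (T : Chain (m + 1) i j) (x : Fin (n.len + 1)) :
    ULift.up (T.retraction.toOrderHom x) ∈ T.set (Fin.last m) :=
  T.exists_retraction.choose_spec.1 x

theorem retraction_apply (T : Chain (m + 1) i j) {t : Ord.{w} n} (ht : t ∈ T.set (Fin.last m)) :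
    T.retraction.toOrderHom t.down = t.down :=
  T.exists_retraction.choose_spec.2 t ht

/-- A chain is small if its largest member is contained in a face of the horn which belongs
to `k`. -/
def IsSmall (k : Fin (n.len + 1)) (T : Chain (m + 1) i j) : Prop :=
  ∃ l, l ≠ k ∧ ULift.up l ∉ T.set (Fin.last m)

theorem map_eq_of_fixed (T : Chain (m + 1) i j) (α : n ⟶ n)
    (h : ∀ t ∈ T.set (Fin.last m), α.toOrderHom t.down = t.down) :
    (T.map (DiagramFamily.ordMap α) (DiagramFamily.ordMap_monotone α)).set = T.set := by
  have h' : ∀ s, ∀ t ∈ T.set s, DiagramFamily.ordMap α t = t := fun s t ht =>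
    ULift.ext _ _ (h t (T.mono (Fin.le_last s) ht))
  funext s
  exact (Set.image_congr (h' s)).trans (Set.image_id' _)

end Chain

namespace DiagramFamily

variable {n : SimplexCategory} {k : Fin (n.len + 1)} {S : Type u} [EnrichedCategory SSet.{w} S]
  (Φ : DiagramFamily.{w} (Fin (n.len + 1)) S)
  (hΦ : ∀ {a : SimplexCategory} (α : a ⟶ n), (∃ l, l ≠ k ∧ ∀ x, α.toOrderHom x ≠ l) →
    Φ.mem a (finFunctor α))

include hΦ in
-- The retraction omits the same vertex as the chain, so it is a degenerate `n`-simplex of the horn.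
-- Evaluating there avoids the choice of a face containing the chain.
theorem mem_retraction {m : ℕ} {i j : Ord.{w} n} {T : Chain (m + 1) i j} (hT : T.IsSmall k) :
    Φ.mem n (finFunctor T.retraction) := by
  obtain ⟨l, hl, h⟩ := hT
  exact hΦ _ ⟨l, hl, fun x hx => h (hx ▸ T.retraction_mem x)⟩

/-- The value of a family of diagrams on a horn on a small chain. -/
noncomputable def hornVal (m : SimplexCategory) {i j : Ord.{w} n} (T : Chain (m.len + 1) i j)
    (hT : T.IsSmall k) : SHom m (Φ.obj i.down) (Φ.obj j.down) :=
  SHom.cast (congrArg Φ.obj (T.retraction_apply (T.left _)))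
    (congrArg Φ.obj (T.retraction_apply (T.right _))) (Φ.cval (Φ.mem_retraction hΦ hT) m T)

/-- Since `α` fixes the image of the retraction, the retraction followed by `α` is the retraction
itself. Several chains can thus be evaluated at one simplex. -/
theorem hornVal_eq (m : SimplexCategory) {i j : Ord.{w} n} (T : Chain (m.len + 1) i j)
    (hT : T.IsSmall k) (α : n ⟶ n) (hα : Φ.mem n (finFunctor α))
    (h : ∀ t ∈ T.set (Fin.last m.len), α.toOrderHom t.down = t.down) :
    Φ.hornVal hΦ m T hT = SHom.cast (congrArg Φ.obj (h _ (T.left _)))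
      (congrArg Φ.obj (h _ (T.right _))) (Φ.cval hα m T) := by
  have e : finFunctor T.retraction ⋙ finFunctor α = finFunctor T.retraction := by
    refine congrArg finFunctor (a₁ := T.retraction ≫ α) (SimplexCategory.Hom.ext _ _
      (OrderHom.ext _ _ (funext fun x => h _ (T.retraction_mem x))))
  have h1 := Φ.cval_congr (Φ.mem_comp T.retraction hα) e m T T rfl rfl rfl
  have h2 := Φ.cval_map hα T.retraction m T
  have h3 := Φ.cval_congr hα rfl m (T.map (ordMap T.retraction) (ordMap_monotone _)) T
    (ULift.ext _ _ (T.retraction_apply (T.left _))) (ULift.ext _ _ (T.retraction_apply (T.right _)))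
    (T.map_eq_of_fixed _ fun t ht => T.retraction_apply ht)
  unfold hornVal
  refine (congrArg (SHom.cast _ _) h1.symm).trans ((SHom.cast_cast _ _ _ _ _).trans ?_)
  refine Eq.trans ?_ (congrArg (SHom.cast _ _) h3)
  exact (congrArg (SHom.cast _ _) h2).trans (SHom.cast_cast _ _ _ _ _).symm

theorem hornVal_id (m : SimplexCategory) (i : Ord.{w} n) (hT : (Chain.id (m.len + 1) i).IsSmall k) :
    Φ.hornVal hΦ m (Chain.id (m.len + 1) i) hT = SHom.id m _ := by
  unfold hornVal
  exact (congrArg (SHom.cast _ _) (Φ.cval_id _ m i)).trans (SHom.cast_id _)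

/-- The retraction of the concatenation fixes both parts, so all three values are taken in one
diagram. -/
theorem hornVal_comp (m : SimplexCategory) {i j l : Ord.{w} n} (T : Chain (m.len + 1) i j)
    (T' : Chain (m.len + 1) j l) (h : (T.comp T').IsSmall k) (hT : T.IsSmall k)
    (hT' : T'.IsSmall k) :
    Φ.hornVal hΦ m (T.comp T') h = (Φ.hornVal hΦ m T hT).comp (Φ.hornVal hΦ m T' hT') := by
  have hα := Φ.mem_retraction hΦ h
  refine Eq.trans ?_ (congrArg₂ SHom.comp
    (Φ.hornVal_eq hΦ m T hT _ hα fun t ht => (T.comp T').retraction_apply (Or.inl ht))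
    (Φ.hornVal_eq hΦ m T' hT' _ hα fun t ht => (T.comp T').retraction_apply (Or.inr ht))).symm
  exact (congrArg (SHom.cast _ _) (Φ.cval_comp hα m T T')).trans (SHom.cast_comp _ _ _ _ _)

theorem hornVal_op {l m : SimplexCategory} (α : l ⟶ m) {i j : Ord.{w} n}
    (T : Chain (m.len + 1) i j) (hT : T.IsSmall k) (hT' : (T.op α.toOrderHom).IsSmall k) :
    Φ.hornVal hΦ l (T.op α.toOrderHom) hT' = SHom.op α (Φ.hornVal hΦ m T hT) := by
  have hα := Φ.mem_retraction hΦ hT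
  refine (Φ.hornVal_eq hΦ l _ hT' _ hα fun t ht =>
    T.retraction_apply (T.mono (Fin.le_last (α.toOrderHom (Fin.last l.len))) ht)).trans ?_
  exact (congrArg (SHom.cast _ _) (Φ.cval_op hα α T)).trans (SHom.cast_op _ _ _ _)

/-- Both sides equal the value at the simplex `T.retraction ≫ α`, which does not change when
followed by the retraction of the image chain. -/
theorem hornVal_map (m : SimplexCategory) {a : SimplexCategory} (α : a ⟶ n)
    (hα : Φ.mem a (finFunctor α)) {i j : Ord.{w} a} (T : Chain (m.len + 1) i j)
    (hT : (T.map (ordMap α) (ordMap_monotone α)).IsSmall k) :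
    Φ.hornVal hΦ m (T.map (ordMap α) (ordMap_monotone α)) hT = Φ.cval hα m T := by
  set T' := T.map (ordMap α) (ordMap_monotone α) with hT'
  have e : finFunctor (T.retraction ≫ α) ⋙ finFunctor T'.retraction =
      finFunctor T.retraction ⋙ finFunctor α := by
    refine congrArg finFunctor (a₁ := (T.retraction ≫ α) ≫ T'.retraction)
      (a₂ := T.retraction ≫ α) (SimplexCategory.Hom.ext _ _
      (OrderHom.ext _ _ (funext fun x => ?_)))
    exact T'.retraction_apply (t := ordMap α ⟨T.retraction.toOrderHom x⟩)
      ⟨_, T.retraction_mem x, rfl⟩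
  have hα' := Φ.mem_retraction hΦ hT
  have h1 := Φ.cval_congr (Φ.mem_comp (T.retraction ≫ α) hα') e m T T rfl rfl rfl
  have h2 := Φ.cval_map hα T.retraction m T
  have hfix : ∀ t ∈ T.set (Fin.last m.len), T.retraction.toOrderHom t.down = t.down :=
    fun t ht => T.retraction_apply ht
  have h3 := Φ.cval_congr hα rfl m (T.map (ordMap T.retraction) (ordMap_monotone _)) T
    (ULift.ext _ _ (T.retraction_apply (T.left _))) (ULift.ext _ _ (T.retraction_apply (T.right _)))
    (T.map_eq_of_fixed _ hfix)
  have h4 := Φ.cval_map hα' (T.retraction ≫ α) m T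
  have h5 := Φ.cval_congr hα' rfl m (T.map (ordMap (T.retraction ≫ α)) (ordMap_monotone _)) T'
    (ULift.ext _ _ (congrArg α.toOrderHom (hfix _ (T.left _))))
    (ULift.ext _ _ (congrArg α.toOrderHom (hfix _ (T.right _)))) (by
      funext s
      refine Set.image_congr fun t ht => ULift.ext _ _ (congrArg α.toOrderHom ?_)
      exact hfix t (T.mono (Fin.le_last s) ht))
  unfold hornVal
  refine (congrArg (SHom.cast _ _) (h5.symm.trans (congrArg (SHom.cast _ _) h4.symm))).trans ?_
  refine Eq.trans ?_ h3
  refine Eq.trans ?_ (congrArg (SHom.cast _ _) h2)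
  refine Eq.trans ?_ (congrArg (SHom.cast _ _) h1)
  exact (SHom.cast_cast _ _ _ _ _).trans (SHom.cast_cast _ _ _ _ _).symm

end DiagramFamily

end

/-! ### Small and decomposable chains, and the values they force on a filler -/

section

namespace Chain

variable {n : SimplexCategory} {k : Fin (n.len + 1)} {m : ℕ} {i j l : Ord.{w} n}

/-- With `isSmall_of_ne_zero`, this leaves only chains from the first to the last vertex to be
filled in an inner horn. -/
theorem isSmall_of_ne_last (hk : Fin.last n.len ≠ k) (T : Chain (m + 1) i j)
    (h : j.down ≠ Fin.last n.len) : T.IsSmall k :=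
  ⟨Fin.last n.len, hk, fun ht => h (Fin.last_le_iff.1 (T.bdd _ ht).2)⟩

theorem isSmall_of_ne_zero (hk : 0 ≠ k) (T : Chain (m + 1) i j)
    (h : i.down ≠ 0) : T.IsSmall k :=
  ⟨0, hk, fun ht => h (Fin.le_zero_iff.1 (T.bdd _ ht).1)⟩

theorem IsSmall.op {m' : ℕ} {T : Chain (m + 1) i j} (hT : T.IsSmall k)
    (α : Fin (m' + 1) →o Fin (m + 1)) : (T.op α).IsSmall k := by
  obtain ⟨l, hl, h⟩ := hT
  exact ⟨l, hl, fun ht => h (T.mono (Fin.le_last (α (Fin.last m'))) ht)⟩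

theorem IsSmall.left {T : Chain (m + 1) i j} {T' : Chain (m + 1) j l}
    (h : (T.comp T').IsSmall k) : T.IsSmall k := by
  obtain ⟨l, hl, h⟩ := h
  exact ⟨l, hl, fun ht => h (Or.inl ht)⟩

theorem IsSmall.right {T : Chain (m + 1) i j} {T' : Chain (m + 1) j l}
    (h : (T.comp T').IsSmall k) : T'.IsSmall k := by
  obtain ⟨l, hl, h⟩ := h
  exact ⟨l, hl, fun ht => h (Or.inr ht)⟩

/-- A chain is decomposable if it is the concatenation of two chains which do not connect the
endpoints. -/
def IsDecomposable (T : Chain (m + 1) (⟨0⟩ : Ord.{w} n) ⟨Fin.last n.len⟩) : Prop :=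
  ∃ (t : Ord.{w} n) (P : Chain (m + 1) ⟨0⟩ t) (Q : Chain (m + 1) t ⟨Fin.last n.len⟩),
    (t.down ≠ 0 ∧ t.down ≠ Fin.last n.len) ∧ P.comp Q = T

/-- Elements of the smallest set lie in all the sets, and a chain can be cut at exactly such
elements. -/
theorem isDecomposable_iff (T : Chain (m + 1) (⟨0⟩ : Ord.{w} n) ⟨Fin.last n.len⟩) :
    T.IsDecomposable ↔ ∃ t ∈ T.set 0, t.down ≠ 0 ∧ t.down ≠ Fin.last n.len := by
  constructor
  · rintro ⟨t, P, Q, ht, rfl⟩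
    exact ⟨t, Or.inl (P.right 0), ht⟩
  · rintro ⟨t, h, ht⟩
    exact ⟨t, T.before t (Fin.zero_le t.down) (T.mem_of_mem_zero h),
      T.after t (Fin.le_last t.down) (T.mem_of_mem_zero h), ht, T.before_comp_after t _ _ _⟩

theorem IsDecomposable.op {m' : ℕ} {T : Chain (m + 1) (⟨0⟩ : Ord.{w} n) ⟨Fin.last n.len⟩}
    (hT : T.IsDecomposable) (α : Fin (m' + 1) →o Fin (m + 1)) : (T.op α).IsDecomposable := by
  obtain ⟨t, P, Q, ht, rfl⟩ := hT
  exact ⟨t, P.op α, Q.op α, ht, rfl⟩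

/-- The chains on which the filler of a horn is determined. -/
def IsDetermined (k : Fin (n.len + 1)) (T : Chain (m + 1) (⟨0⟩ : Ord.{w} n) ⟨Fin.last n.len⟩) :
    Prop :=
  T.IsSmall k ∨ T.IsDecomposable

theorem IsDetermined.op {m' : ℕ} {T : Chain (m + 1) (⟨0⟩ : Ord.{w} n) ⟨Fin.last n.len⟩}
    (hT : T.IsDetermined k) (α : Fin (m' + 1) →o Fin (m + 1)) : (T.op α).IsDetermined k :=
  hT.imp (fun h => h.op α) fun h => h.op α

end Chain

namespace DiagramFamily

variable {n : SimplexCategory} {k : Fin (n.len + 1)} {S : Type u} [EnrichedCategory SSet.{w} S]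
  (Φ : DiagramFamily.{w} (Fin (n.len + 1)) S)
  (hΦ : ∀ {a : SimplexCategory} (α : a ⟶ n), (∃ l, l ≠ k ∧ ∀ x, α.toOrderHom x ≠ l) →
    Φ.mem a (finFunctor α))
  (h0 : 0 ≠ k) (h1 : Fin.last n.len ≠ k)

/-- The value of a family of diagrams on a horn on a concatenation of two chains. -/
noncomputable def hornPair (m : SimplexCategory) {t : Ord.{w} n} (ht : t.down ≠ 0)
    (ht' : t.down ≠ Fin.last n.len) (P : Chain (m.len + 1) ⟨0⟩ t)
    (Q : Chain (m.len + 1) t ⟨Fin.last n.len⟩) : SHom m (Φ.obj 0) (Φ.obj (Fin.last n.len)) :=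
  (Φ.hornVal hΦ m P (P.isSmall_of_ne_last h1 ht')).comp
    (Φ.hornVal hΦ m Q (Q.isSmall_of_ne_zero h0 ht))

/-- Cutting at both `t` and `t'` gives a common refinement into three small chains, and
associativity compares its two bracketings. -/
theorem hornPair_congr_of_le (m : SimplexCategory) {t t' : Ord.{w} n} (ht : t.down ≠ 0)
    (ht' : t.down ≠ Fin.last n.len) (hs : t'.down ≠ 0) (hs' : t'.down ≠ Fin.last n.len)
    (P : Chain (m.len + 1) ⟨0⟩ t) (Q : Chain (m.len + 1) t ⟨Fin.last n.len⟩)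
    (P' : Chain (m.len + 1) ⟨0⟩ t') (Q' : Chain (m.len + 1) t' ⟨Fin.last n.len⟩)
    (h : P.comp Q = P'.comp Q') (hle : t ≤ t') :
    Φ.hornPair hΦ h0 h1 m ht ht' P Q = Φ.hornPair hΦ h0 h1 m hs hs' P' Q' := by
  have hQ : ∀ s, t' ∈ Q.set s := by
    intro s
    have : t' ∈ (P.comp Q).set s := by
      rw [h]
      exact Or.inl (P'.right s)
    rcases this with h' | h'
    · obtain rfl : t = t' := le_antisymm hle (P.bdd s h').2
      exact Q.left s
    · exact h'
  have e := Q.before_comp_after t' hle (Fin.le_last t'.down) hQ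
  have e' : (P.comp (Q.before t' hle hQ)).comp (Q.after t' (Fin.le_last t'.down) hQ) =
      P'.comp Q' := by
    rw [← h]
    refine Eq.trans ?_ (congrArg P.comp e)
    exact Chain.ext (funext fun s => Set.union_assoc _ _ _)
  obtain ⟨rfl, rfl⟩ := Chain.comp_inj e'
  have hY := (Q.before t' hle hQ).isSmall_of_ne_zero (k := k) h0 ht
  have hZ := (Q.after t' (Fin.le_last t'.down) hQ).isSmall_of_ne_zero (k := k) h0 hs
  have hP := P.isSmall_of_ne_last (k := k) h1 ht'
  have hPY := (P.comp (Q.before t' hle hQ)).isSmall_of_ne_last (k := k) h1 hs'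
  have hYZ := ((Q.before t' hle hQ).comp
    (Q.after t' (Fin.le_last t'.down) hQ)).isSmall_of_ne_zero (k := k) h0 ht
  have e1 := Φ.hornVal_comp hΦ m _ _ hPY hP hY
  have e2 := Φ.hornVal_comp hΦ m _ _ hYZ hY hZ
  have e3 : Φ.hornVal hΦ m Q (Q.isSmall_of_ne_zero h0 ht) = _ :=
    (by congr 1; exact e.symm : Φ.hornVal hΦ m Q (Q.isSmall_of_ne_zero h0 ht) =
      Φ.hornVal hΦ m _ hYZ).trans e2
  unfold hornPair
  rw [e1, e3]
  exact (SHom.assoc _ _ _).symm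

open Classical in
/-- The value of the filler of a horn on the chains on which it is determined. -/
noncomputable def hornGlue (m : SimplexCategory)
    (T : Chain (m.len + 1) (⟨0⟩ : Ord.{w} n) ⟨Fin.last n.len⟩) (hT : T.IsDetermined k) :
    SHom m (Φ.obj 0) (Φ.obj (Fin.last n.len)) :=
  if h : T.IsSmall k then Φ.hornVal hΦ m T h else
    have h' := hT.resolve_left h
    Φ.hornPair hΦ h0 h1 m h'.choose_spec.choose_spec.choose_spec.1.1
      h'.choose_spec.choose_spec.choose_spec.1.2 h'.choose_spec.choose
      h'.choose_spec.choose_spec.choose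

theorem hornGlue_of_isSmall (m : SimplexCategory)
    (T : Chain (m.len + 1) (⟨0⟩ : Ord.{w} n) ⟨Fin.last n.len⟩) (hT : T.IsDetermined k)
    (h : T.IsSmall k) : Φ.hornGlue hΦ h0 h1 m T hT = Φ.hornVal hΦ m T h := by
  rw [hornGlue, dif_pos h]

/-- The choices made in `hornGlue` do not matter: on small chains the values are functorial, and
otherwise the chosen cut point is comparable with `t`. -/
theorem hornGlue_comp (m : SimplexCategory) {t : Ord.{w} n} (ht : t.down ≠ 0)
    (ht' : t.down ≠ Fin.last n.len) (P : Chain (m.len + 1) ⟨0⟩ t)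
    (Q : Chain (m.len + 1) t ⟨Fin.last n.len⟩) (h : (P.comp Q).IsDetermined k) :
    Φ.hornGlue hΦ h0 h1 m (P.comp Q) h = Φ.hornPair hΦ h0 h1 m ht ht' P Q := by
  by_cases hs : (P.comp Q).IsSmall k
  · rw [hornGlue_of_isSmall _ _ _ _ _ _ _ hs]
    exact Φ.hornVal_comp hΦ m P Q hs _ _
  · rw [hornGlue, dif_neg hs]
    have h' := h.resolve_left hs
    have h'' := h'.choose_spec.choose_spec.choose_spec
    rcases le_total t h'.choose with hle | hle
    · exact (Φ.hornPair_congr_of_le hΦ h0 h1 m _ _ _ _ _ _ _ _ h''.2.symm hle).symm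
    · exact Φ.hornPair_congr_of_le hΦ h0 h1 m _ _ _ _ _ _ _ _ h''.2 hle

theorem hornGlue_op {l m : SimplexCategory} (α : l ⟶ m)
    (T : Chain (m.len + 1) (⟨0⟩ : Ord.{w} n) ⟨Fin.last n.len⟩) (hT : T.IsDetermined k)
    (hT' : (T.op α.toOrderHom).IsDetermined k) :
    Φ.hornGlue hΦ h0 h1 l (T.op α.toOrderHom) hT' =
      SHom.op α (Φ.hornGlue hΦ h0 h1 m T hT) := by
  by_cases h : T.IsSmall k
  · rw [hornGlue_of_isSmall _ _ _ _ _ _ _ h, hornGlue_of_isSmall _ _ _ _ _ _ _ (h.op _)]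
    exact Φ.hornVal_op hΦ α T h _
  · obtain ⟨t, P, Q, ⟨ht, ht'⟩, rfl⟩ := hT.resolve_left h
    rw [Φ.hornGlue_comp hΦ h0 h1 m ht ht' P Q]
    refine (Φ.hornGlue_comp hΦ h0 h1 l ht ht' (P.op α.toOrderHom) (Q.op α.toOrderHom) hT').trans ?_
    unfold hornPair
    rw [SHom.op_comp]
    exact congrArg₂ SHom.comp (Φ.hornVal_op hΦ α P _ _) (Φ.hornVal_op hΦ α Q _ _)

end DiagramFamily

end

/-! ### Extension to the space of all chains -/

section

open Simplicial SSet

open modelCategoryQuillen in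
theorem exists_extension_of_anodyne {X M : SSet.{w}} (A : X.Subcomplex) [SSet.KanComplex M]
    (hA : SSet.anodyneExtensions A.ι) (f : (A : SSet.{w}) ⟶ M) : ∃ g : X ⟶ M, A.ι ≫ g = f := by
  have : HasLiftingProperty A.ι (Limits.terminal.from M) :=
    hA _ ((HomotopicalAlgebra.isFibrant_iff _).1 inferInstance).mem
  have sq : CommSq f A.ι (Limits.terminal.from M) (Limits.terminal.from _) := ⟨by simp⟩
  exact ⟨sq.lift, sq.fac_left⟩

variable {n : SimplexCategory} {k : Fin (n.len + 1)}

/-- The simplicial set of chains between two elements. -/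
def chainSpace (i j : Ord.{w} n) : SSet.{w} where
  obj m := Chain (m.unop.len + 1) i j
  map α := ↾fun T => T.op α.unop.toOrderHom

/-- The subcomplex of chains which are contained in some face of the cube other than those which
belong to `k`. -/
def chainBoundary (k : Fin (n.len + 1)) :
    (chainSpace (⟨0⟩ : Ord.{w} n) ⟨Fin.last n.len⟩).Subcomplex where
  obj m := Set.ofPred fun T : Chain (m.unop.len + 1) (⟨0⟩ : Ord.{w} n) ⟨Fin.last n.len⟩ =>
    ∃ t : Ord.{w} n, (t.down ≠ k ∧ t.down ≠ 0 ∧ t.down ≠ Fin.last n.len) ∧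
      (t ∈ T.set 0 ∨ t ∉ T.set (Fin.last m.unop.len))
  map {m m'} α T := by
    rintro ⟨t, ht, h⟩
    refine ⟨t, ht, h.imp (fun h => ?_) fun h h' => h ?_⟩
    · exact Chain.mem_of_mem_zero (m := m.unop.len) T h _
    · exact Chain.mono (m := m.unop.len + 1) T (Fin.le_last _) h'

/-- The chain in which the membership of `k` is given by a simplex of an interval. -/
def Chain.modify (h0 : 0 ≠ k) (h1 : Fin.last n.len ≠ k) {m : ℕ}
    (T : Chain m (⟨0⟩ : Ord.{w} n) ⟨Fin.last n.len⟩) (y : Fin m →o Fin 2) :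
    Chain m (⟨0⟩ : Ord.{w} n) ⟨Fin.last n.len⟩ where
  set s := {t | (t.down ≠ k ∧ t ∈ T.set s) ∨ (t.down = k ∧ y s = 1)}
  mono a b h t ht := ht.imp (fun ht => ⟨ht.1, T.mono h ht.2⟩) fun ht => ⟨ht.1, by
    have := y.monotone h
    rw [ht.2] at this
    exact Fin.last_le_iff.1 this⟩
  le := T.le
  left s := Or.inl ⟨h0, T.left s⟩
  right s := Or.inl ⟨h1, T.right s⟩
  bdd _ t _ := ⟨Fin.zero_le t.down, Fin.le_last t.down⟩

open Classical in
/-- The simplex of an interval given by the membership of `k` in the sets of a chain. -/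
noncomputable def Chain.indicator (k : Fin (n.len + 1)) {m : ℕ} {i j : Ord.{w} n}
    (T : Chain m i j) : Fin m →o Fin 2 where
  toFun s := if ULift.up k ∈ T.set s then 1 else 0
  monotone' a b h := by
    by_cases ha : ULift.up k ∈ T.set a
    · simp [ha, T.mono h ha]
    · simp [ha]

theorem Chain.indicator_eq_one_iff {m : ℕ} {i j : Ord.{w} n}
    (T : Chain m i j) (s : Fin m) : T.indicator k s = 1 ↔ ULift.up k ∈ T.set s := by
  classical
  change (if ULift.up k ∈ T.set s then (1 : Fin 2) else 0) = 1 ↔ _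
  split_ifs with h <;> simp [h]

theorem Chain.modify_indicator (h0 : 0 ≠ k) (h1 : Fin.last n.len ≠ k) {m : ℕ}
    (T : Chain m (⟨0⟩ : Ord.{w} n) ⟨Fin.last n.len⟩) :
    T.modify h0 h1 (T.indicator k) = T := by
  ext s ⟨t⟩
  change (t ≠ k ∧ _) ∨ (t = k ∧ T.indicator k s = 1) ↔ _
  rw [T.indicator_eq_one_iff]
  by_cases h : t = k
  · subst h; simp
  · simp [h]

/-- A simplex lies in this horn when it omits the vertex `0`, so the horn is the end `1` of the
interval. -/
theorem mem_horn_one_one_iff {m : SimplexCategoryᵒᵖ} (y : (Δ[1] : SSet.{w}).obj m) :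
    y ∈ (Λ[1, 1] : (Δ[1] : SSet.{w}).Subcomplex).obj m ↔ ∀ s, stdSimplex.asOrderHom y s = 1 := by
  rw [SSet.mem_horn_iff, Ne, Set.eq_univ_iff_forall]
  constructor
  · intro h s
    by_contra hs
    refine h fun x => ?_
    by_cases hx : x = 1
    · exact Or.inr hx
    · refine Or.inl ⟨s, ?_⟩
      exact Fin.fin_two_eq_of_eq_zero_iff (by omega)
  · intro h h'
    rcases h' 0 with ⟨s, hs⟩ | h'
    · exact absurd ((h s).symm.trans hs) (by decide)
    · exact absurd (Set.mem_singleton_iff.1 h') (by decide)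

/-- If the interval coordinate is constantly `1`, the chain decomposes at `k`. Otherwise a
coordinate `t ≠ k` is constant: the chain decomposes at `t` if it is `1`, and is small if it is `0`.
-/
theorem Chain.isDetermined_modify (h0 : 0 ≠ k) (h1 : Fin.last n.len ≠ k) {m : SimplexCategoryᵒᵖ}
    (p : (chainSpace (⟨0⟩ : Ord.{w} n) ⟨Fin.last n.len⟩ ⊗ Δ[1]).obj m)
    (hp : p ∈ ((chainBoundary k).unionProd Λ[1, 1]).obj m) :
    (Chain.modify h0 h1 (m := m.unop.len + 1) p.1 (stdSimplex.asOrderHom p.2)).IsDetermined k := by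
  rcases ((Subcomplex.mem_unionProd_iff _ _ _).1 hp).imp_left
    (mem_horn_one_one_iff _).1 with hp | ⟨t, ⟨ht, ht', ht''⟩, hp | hp⟩
  · exact Or.inr ((Chain.isDecomposable_iff _).2 ⟨⟨k⟩, Or.inr ⟨rfl, hp 0⟩, h0.symm, h1.symm⟩)
  · exact Or.inr ((Chain.isDecomposable_iff _).2 ⟨t, Or.inl ⟨ht, hp⟩, ht', ht''⟩)
  · refine Or.inl ⟨t.down, ht, ?_⟩
    rintro (h | h)
    · exact hp h.2
    · exact ht h.1

/-- With `Chain.isDetermined_modify` and `Chain.modify_indicator`, this exhibits the inclusion of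
the determined chains as a retract of a pushout product. -/
theorem Chain.mem_unionProd {m : SimplexCategory}
    (T : Chain (m.len + 1) (⟨0⟩ : Ord.{w} n) ⟨Fin.last n.len⟩) (hT : T.IsDetermined k) :
    ((T, stdSimplex.objMk (T.indicator k)) : Chain (m.len + 1) (⟨0⟩ : Ord.{w} n) ⟨Fin.last n.len⟩ ×
      (Δ[1] : SSet.{w}).obj (Opposite.op m)) ∈
        ((chainBoundary k).unionProd Λ[1, 1]).obj (Opposite.op m) := by
  refine (Subcomplex.mem_unionProd_iff _ _ _).2 (Or.imp_left (mem_horn_one_one_iff _).2 ?_)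
  rcases hT with ⟨l, hl, h⟩ | hT
  · refine Or.inr ⟨⟨l⟩, ⟨hl, fun (e : l = 0) => ?_, fun (e : l = Fin.last n.len) => ?_⟩, Or.inr h⟩
    · subst e; exact h (T.left _)
    · subst e; exact h (T.right _)
  · obtain ⟨t, ht, h2, h3⟩ := (Chain.isDecomposable_iff _).1 hT
    by_cases h : t.down = k
    · exact Or.inl fun s => (T.indicator_eq_one_iff s).2
        (h ▸ T.mem_of_mem_zero ht s)
    · exact Or.inr ⟨t, ⟨h, h2, h3⟩, Or.inl ht⟩

/-- A map which is defined on the determined chains extends to all chains if its target is a Kan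
complex. -/
theorem exists_chain_extension (h0 : 0 ≠ k) (h1 : Fin.last n.len ≠ k) (M : SSet.{w}) [KanComplex M]
    (f : ∀ (m : SimplexCategory) (T : Chain (m.len + 1) (⟨0⟩ : Ord.{w} n) ⟨Fin.last n.len⟩),
      T.IsDetermined k → M.obj (Opposite.op m))
    (hf : ∀ {l m : SimplexCategory} (α : l ⟶ m)
      (T : Chain (m.len + 1) (⟨0⟩ : Ord.{w} n) ⟨Fin.last n.len⟩) (hT : T.IsDetermined k),
      f l (T.op α.toOrderHom) (hT.op _) = M.map α.op (f m T hT)) :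
    ∃ g : chainSpace (⟨0⟩ : Ord.{w} n) ⟨Fin.last n.len⟩ ⟶ M,
      ∀ (m : SimplexCategory) (T : Chain (m.len + 1) (⟨0⟩ : Ord.{w} n) ⟨Fin.last n.len⟩)
        (hT : T.IsDetermined k), g.app (Opposite.op m) T = f m T hT := by
  -- The map `f` is pulled back along `Chain.modify`, extended over the product by anodyneness, and
  -- restricted along the section given by `Chain.indicator`.
  let φ : (((chainBoundary k).unionProd Λ[1, 1] : Subcomplex _) : SSet.{w}) ⟶ M :=
    { app m := ↾fun p => f m.unop _ (Chain.isDetermined_modify h0 h1 p.1 p.2)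
      naturality m m' α := by
        ext p
        exact hf α.unop _ (Chain.isDetermined_modify h0 h1 p.1 p.2) }
  obtain ⟨ψ, hψ⟩ := exists_extension_of_anodyne _
    (anodyneExtensions_unionProd_ι (chainBoundary k) Λ[1, 1] (anodyneExtensions.horn_ι 1)) φ
  let ι : chainSpace (⟨0⟩ : Ord.{w} n) ⟨Fin.last n.len⟩ ⟶
      chainSpace (⟨0⟩ : Ord.{w} n) ⟨Fin.last n.len⟩ ⊗ Δ[1] :=
    { app m := ↾fun T => (T, stdSimplex.objMk (Chain.indicator k (m := m.unop.len + 1) T))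
      naturality m m' α := rfl }
  refine ⟨ι ≫ ψ, fun m T hT => ?_⟩
  have h := ConcreteCategory.congr_hom (NatTrans.congr_app hψ (Opposite.op m))
    ⟨_, Chain.mem_unionProd T hT⟩
  refine h.trans ?_
  change f m (T.modify h0 h1 (T.indicator k)) _ = _
  congr 1
  exact T.modify_indicator h0 h1

end

end HoCoh

universe v

namespace HoCoh

/-! ### Fillers of inner horns in the homotopy coherent nerve -/

section

open Simplicial

namespace DiagramFamily

variable {n : SimplexCategory} {k : Fin (n.len + 1)} {S : Type u} [EnrichedCategory SSet.{w} S]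
  (Φ : DiagramFamily.{w} (Fin (n.len + 1)) S)
  (hΦ : ∀ {a : SimplexCategory} (α : a ⟶ n), (∃ l, l ≠ k ∧ ∀ x, α.toOrderHom x ≠ l) →
    Φ.mem a (finFunctor α))
  (h0 : 0 ≠ k) (h1 : Fin.last n.len ≠ k)
  (g : chainSpace (⟨0⟩ : Ord.{w} n) ⟨Fin.last n.len⟩ ⟶
    EnrichedCategory.Hom (Φ.obj 0) (Φ.obj (Fin.last n.len)))
  (hg : ∀ (m : SimplexCategory) (T : Chain (m.len + 1) (⟨0⟩ : Ord.{w} n) ⟨Fin.last n.len⟩)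
    (hT : T.IsDetermined k), g.app (Opposite.op m) T = Φ.hornGlue hΦ h0 h1 m T hT)

include h0 h1 in
theorem isSmall_of_not {m : ℕ} {i j : Ord.{w} n} (T : Chain (m + 1) i j)
    (h : ¬ (i = ⟨0⟩ ∧ j = ⟨Fin.last n.len⟩)) : T.IsSmall k := by
  by_cases hi : i.down = 0
  · exact T.isSmall_of_ne_last h1 fun hj => h ⟨ULift.ext _ _ hi, ULift.ext _ _ hj⟩
  · exact T.isSmall_of_ne_zero h0 hi

open Classical in
/-- The values of the filler of a horn. -/
noncomputable def fillVal (m : SimplexCategory) {i j : Ord.{w} n} (T : Chain (m.len + 1) i j) :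
    SHom m (Φ.obj i.down) (Φ.obj j.down) :=
  if h : i = ⟨0⟩ ∧ j = ⟨Fin.last n.len⟩ then
    SHom.cast (congrArg (fun i => Φ.obj i.down) h.1.symm)
      (congrArg (fun j => Φ.obj j.down) h.2.symm)
      (g.app (Opposite.op m) (h.1 ▸ h.2 ▸ T : Chain (m.len + 1) _ _))
  else Φ.hornVal hΦ m T (isSmall_of_not h0 h1 T h)

theorem fillVal_zero_last (m : SimplexCategory)
    (T : Chain (m.len + 1) (⟨0⟩ : Ord.{w} n) ⟨Fin.last n.len⟩) :
    Φ.fillVal hΦ h0 h1 g m T = g.app (Opposite.op m) T := by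
  rw [fillVal, dif_pos ⟨rfl, rfl⟩]
  rfl

include hg

theorem fillVal_of_isSmall (m : SimplexCategory) {i j : Ord.{w} n} (T : Chain (m.len + 1) i j)
    (hT : T.IsSmall k) : Φ.fillVal hΦ h0 h1 g m T = Φ.hornVal hΦ m T hT := by
  by_cases h : i = ⟨0⟩ ∧ j = ⟨Fin.last n.len⟩
  · obtain ⟨rfl, rfl⟩ := h
    refine (Φ.fillVal_zero_last hΦ h0 h1 g m T).trans ?_
    exact (hg m T (Or.inl hT)).trans (Φ.hornGlue_of_isSmall hΦ h0 h1 m T _ hT)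
  · rw [fillVal, dif_neg h]

theorem fillVal_id (m : SimplexCategory) (i : Ord.{w} n) :
    Φ.fillVal hΦ h0 h1 g m (Chain.id (m.len + 1) i) = SHom.id m (Φ.obj i.down) := by
  -- If the first vertex were also the last, there would be no room for an inner `k`.
  have h : (Chain.id (m.len + 1) i).IsSmall k := isSmall_of_not h0 h1 _ fun h => by
    have e : (0 : Fin (n.len + 1)) = Fin.last n.len := congrArg ULift.down (h.1.symm.trans h.2)
    have h2 := Fin.val_fin_le.2 (Fin.le_last k)
    rw [← e] at h2
    exact h0 (Fin.ext (Nat.le_zero.1 h2).symm)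
  rw [Φ.fillVal_of_isSmall hΦ h0 h1 g hg m _ h, hornVal_id]

/-- A concatenation that is not small joins the first vertex to the last. If it is cut at an end,
one part is an identity; if it is cut at an interior vertex, it is decomposable and `g` takes the
prescribed product there. -/
theorem fillVal_comp (m : SimplexCategory) {i j l : Ord.{w} n} (T : Chain (m.len + 1) i j)
    (T' : Chain (m.len + 1) j l) :
    Φ.fillVal hΦ h0 h1 g m (T.comp T') =
      (Φ.fillVal hΦ h0 h1 g m T).comp (Φ.fillVal hΦ h0 h1 g m T') := by
  by_cases h : (T.comp T').IsSmall k
  · rw [Φ.fillVal_of_isSmall hΦ h0 h1 g hg m _ h, Φ.fillVal_of_isSmall hΦ h0 h1 g hg m _ h.left,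
      Φ.fillVal_of_isSmall hΦ h0 h1 g hg m _ h.right, hornVal_comp]
  · obtain ⟨rfl, rfl⟩ : i = ⟨0⟩ ∧ l = ⟨Fin.last n.len⟩ := by
      by_contra h'
      exact h (isSmall_of_not h0 h1 _ h')
    by_cases hj : j.down = 0
    · obtain rfl : j = ⟨0⟩ := ULift.ext _ _ hj
      obtain rfl := T.eq_id
      rw [Φ.fillVal_id hΦ h0 h1 g hg, SHom.id_comp, Chain.id_comp]
    by_cases hj' : j.down = Fin.last n.len
    · obtain rfl : j = ⟨Fin.last n.len⟩ := ULift.ext _ _ hj'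
      obtain rfl := T'.eq_id
      rw [Φ.fillVal_id hΦ h0 h1 g hg, SHom.comp_id, Chain.comp_id]
    rw [Φ.fillVal_of_isSmall hΦ h0 h1 g hg m T (T.isSmall_of_ne_last h1 hj'),
      Φ.fillVal_of_isSmall hΦ h0 h1 g hg m T' (T'.isSmall_of_ne_zero h0 hj)]
    refine (Φ.fillVal_zero_last hΦ h0 h1 g m _).trans ?_
    rw [hg m _ (Or.inr ⟨j, T, T', ⟨hj, hj'⟩, rfl⟩)]
    exact Φ.hornGlue_comp hΦ h0 h1 m hj hj' T T' _

theorem fillVal_op {l m : SimplexCategory} (α : l ⟶ m) {i j : Ord.{w} n}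
    (T : Chain (m.len + 1) i j) :
    Φ.fillVal hΦ h0 h1 g l (T.op α.toOrderHom) = SHom.op α (Φ.fillVal hΦ h0 h1 g m T) := by
  by_cases h : i = ⟨0⟩ ∧ j = ⟨Fin.last n.len⟩
  · obtain ⟨rfl, rfl⟩ := h
    refine (Φ.fillVal_zero_last hΦ h0 h1 g l _).trans ?_
    refine Eq.trans ?_ (congrArg (SHom.op α) (Φ.fillVal_zero_last hΦ h0 h1 g m T)).symm
    exact ConcreteCategory.congr_hom (g.naturality α.op) T
  · have h' : T.IsSmall k := isSmall_of_not h0 h1 _ h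
    rw [Φ.fillVal_of_isSmall hΦ h0 h1 g hg m T h',
      Φ.fillVal_of_isSmall hΦ h0 h1 g hg l _ (h'.op _), hornVal_op]

theorem exists_fill_of_extension : ∃ F : CoherentDiagram (Ord.{w} n) S,
    ∀ (a : SimplexCategory) (α : a ⟶ n) (h : ∃ l, l ≠ k ∧ ∀ x, α.toOrderHom x ≠ l),
      F.restrict (ordFunctor α) = Φ.diag (hΦ α h) := by
  refine ⟨CoherentDiagram.ofData (fun i => Φ.obj i.down)
    (fun m _ _ p => Φ.fillVal hΦ h0 h1 g m (chainOf p)) (fun m i => ?_) (fun m i j l p q => ?_)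
    (fun α i j p => ?_), fun a α h => ?_⟩
  · rw [chainOf_id]
    exact Φ.fillVal_id hΦ h0 h1 g hg m i
  · rw [chainOf_comp]
    exact Φ.fillVal_comp hΦ h0 h1 g hg m _ _
  · rw [chainOf_op]
    exact Φ.fillVal_op hΦ h0 h1 g hg α _
  · refine CoherentDiagram.ext_of_onHom (fun i => (Φ.onObj_diag (hΦ α h) i).symm)
      fun m i j p => ?_
    -- The image of `α` omits a vertex other than `k`, so only small chains matter, and on these the
    -- filler has the given values.
    have hs : ((chainOf p).map (ordMap α) (ordMap_monotone α)).IsSmall k := by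
      obtain ⟨l, hl, h'⟩ := h
      refine ⟨l, hl, ?_⟩
      rintro ⟨t, -, e⟩
      exact h' t.down (congrArg ULift.down e)
    have e1 := congrArg (Φ.fillVal hΦ h0 h1 g m) (chainOf_iterMap (ordMap_monotone α) p)
    have e2 := Φ.fillVal_of_isSmall hΦ h0 h1 g hg m _ hs
    have e3 := Φ.hornVal_map hΦ m α (hΦ α h) (chainOf p) hs
    rw [cval_chainOf] at e3
    refine (congrArg (SHom.cast _ _) (e1.trans (e2.trans e3))).trans ?_
    exact SHom.cast_cast _ _ _ _ _

omit hg in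
include h0 h1 in
theorem exists_fill [hS : SSet.KanComplex (EnrichedCategory.Hom (Φ.obj 0)
    (Φ.obj (Fin.last n.len)) : SSet.{w})] : ∃ F : CoherentDiagram (Ord.{w} n) S,
    ∀ (a : SimplexCategory) (α : a ⟶ n) (h : ∃ l, l ≠ k ∧ ∀ x, α.toOrderHom x ≠ l),
      F.restrict (ordFunctor α) = Φ.diag (hΦ α h) := by
  obtain ⟨g, hg⟩ := exists_chain_extension h0 h1 _ (Φ.hornGlue hΦ h0 h1)
    fun α T hT => Φ.hornGlue_op hΦ h0 h1 α T hT _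
  exact Φ.exists_fill_of_extension hΦ h0 h1 g hg

end DiagramFamily

variable {S : Type u} [EnrichedCategory SSet.{w} S]

/-- The simplex of a standard simplex given by a functor. -/
abbrev stdSimplexOf {n m : SimplexCategory} (σ : Fin (m.len + 1) ⥤ Fin (n.len + 1)) :
    (SSet.stdSimplex.{v}.obj n).obj (Opposite.op m) :=
  SSet.stdSimplex.objMk ⟨σ.obj, σ.monotone⟩

theorem mem_horn_of_notMem {n : ℕ} {k : Fin (n + 1)} {m : SimplexCategory}
    {σ : Fin (m.len + 1) ⥤ Fin (n + 1)} (h : ∃ l, l ≠ k ∧ ∀ x, σ.obj x ≠ l) :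
    stdSimplexOf.{v} (n := ⦋n⦌) σ ∈ (SSet.horn n k).obj (Opposite.op m) := by
  obtain ⟨l, hl, h⟩ := h
  rw [SSet.mem_horn_iff, Ne, Set.eq_univ_iff_forall, not_forall]
  refine ⟨l, ?_⟩
  rintro (⟨x, hx⟩ | h')
  · exact h x hx
  · exact hl h'

/-- The family of diagrams given by a horn in the homotopy coherent nerve. -/
def hornFamily {n : ℕ} {k : Fin (n + 3)}
    (σ₀ : (SSet.horn (n + 2) k : SSet.{max u w}) ⟶ hcNerve.{w, u} S) :
    DiagramFamily.{w} (Fin (n + 3)) S where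
  mem m σ := ∃ l, l ≠ k ∧ ∀ x, σ.obj x ≠ l
  mem_comp α σ := by
    rintro ⟨l, hl, h⟩
    exact ⟨l, hl, fun x => h _⟩
  mem_const x := by
    -- There are at least three vertices, so some face other than the one opposite to `k` contains
    -- `x`.
    obtain ⟨l, hl⟩ : ∃ l, l ∉ ({k, x} : Finset (Fin (n + 3))) := by
      by_contra! h
      have := Finset.card_le_card (s := Finset.univ) fun l _ => h l
      rw [Finset.card_univ, Fintype.card_fin] at this
      have := this.trans Finset.card_le_two
      omega
    rw [Finset.mem_insert, Finset.mem_singleton, not_or] at hl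
    exact ⟨l, hl.1, fun _ => Ne.symm hl.2⟩
  diag {m} σ h := σ₀.app (Opposite.op m) ⟨_, mem_horn_of_notMem.{max u w} h⟩
  diag_comp {m k} α σ h :=
    ConcreteCategory.congr_hom (σ₀.naturality α.op) ⟨_, mem_horn_of_notMem.{max u w} h⟩

/-- It suffices that the filler restricts correctly to the faces `δ j` with `j ≠ k`, which generate
the horn. -/
theorem quasicategory_hcNerve
    (hS : ∀ X Y : S, SSet.KanComplex (EnrichedCategory.Hom X Y : SSet.{w})) :
    SSet.Quasicategory (hcNerve.{w, u} S) := by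
  refine SSet.quasicategory_of_filler _ fun n k σ₀ h0 h1 => ?_
  obtain ⟨F, hF⟩ := (hornFamily σ₀).exists_fill (n := ⦋n + 2⦌) (k := k)
    (fun α h => h) h0.ne h1.ne' (hS := hS _ _)
  refine ⟨F, fun j hj => ?_⟩
  exact hF ⦋n + 1⦌ (SimplexCategory.δ j) ⟨j, hj, fun x => Fin.succAbove_ne j x⟩

end

end HoCoh

theorem mainTheorem3 (A : Type w) [SmallCategory A] (S : Type u) [EnrichedCategory SSet.{w} S]
    (hS : ∀ X Y : S, SSet.KanComplex (EnrichedCategory.Hom X Y : SSet.{w})) :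
    IsIso (HoCoh.toInternalHom A S) ∧ SSet.Quasicategory (HoCoh.Coh A S) := by
  have := HoCoh.quasicategory_hcNerve hS
  exact ⟨inferInstance, HoCoh.quasicategory_coh⟩
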